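/- Let $0<\varepsilon\le 1$ and $0<\xi<1$. Consider the following randomized algorithm, run synchronously by every node of an anonymous network. The nodes know no parameter of the network. Logarithms $\log$ are to base 2, a loop "for $e=1$ to $x$" is executed for all integers $1\le e\le x$, and $$r(k)=2k^{2(2+\varepsilon)}\log\bigl(k^{2(1+\varepsilon)}\bigr)+k^{1+\varepsilon}\log(2k),\qquad p(k)=\frac{\ln 2}{k^{1+\varepsilon}},$$ $$\tau(k)=1-\frac1{k^{1+\varepsilon}-1},\qquad f(k)=\frac{4\sqrt2\,\ln(k^{1+\varepsilon}/\xi)}{(\sqrt2-1)^2}.$$ A certificate is a pair $(K,id)$; $(K,id)$ beats $(K',id')$ if $K>K'$, or $K=K'$ and $id<id'$; every certificate beats nil. Each node has its own certificate $own$ and a certificate $ldr$ of the presumed leader, both initially nil, and a leader flag, initially false. In the iterations $k=2,4,8,\dots$ (forever), every node does the following. 1. For $e=1$ to $f(k)$ it executes the certification procedure. It becomes white with probability $p(k)$, otherwise black, independently of everything else, and sets $c$ to true if white and to false otherwise, $q\gets$ probing, and $\Phi\gets 0$ if white, $\Phi\gets1$ if black. * Diffusion: for round $=1$ to $r(k)$,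 it broadcasts $\Phi,q,c,ldr$ to its set $N$ of neighbours. If $q$ is probing, $|N|\le k^{1+\varepsilon}$ and all neighbours sent $q_i=$ probing, then $\Phi\gets\Phi+\sum_{i\in N}\Phi_i/(2k^{1+\varepsilon})-|N|\Phi/(2k^{1+\varepsilon})$; otherwise $q\gets$ low, $\Phi\gets1$. In all cases $ldr$ becomes the best of its own and the received $ldr$ certificates. * After these rounds, if $\Phi>\tau(k)$, then $q\gets$ low and $\Phi\gets1$. * Dissemination: for round $=1$ to $k^{1+\varepsilon}$, it broadcasts $q,c,ldr$; it sets $q\gets$ low if some neighbour sent low, $c\gets$ true if some neighbour sent true, and updates $ldr$ as before. 2. If $own$ is nil, more than $f(k)/2$ of these executions ended with $c$ false, and at least one ended with $q$ probing, then it draws $id$ uniformly at random from the integers in $[1,k^{4(1+\varepsilon)}\log^4(4k)]$ and sets $own\gets(k,id)$, $ldr\gets(k,id)$. 3. It sets its leader flag to true if $ldr=own$, and to false otherwise. Potentials are transmitted bit by bit: the broadcast of the $j$-th diffusion round takes $\lceil j\log(2k^{1+\varepsilon})\rceil$ communication rounds; that of a dissemination round takes one. In every communication round each node sends one message over each of its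 links. Explicit Revocable Leader Election is solved within $T$ rounds if there is a node $v$ such that, from round $T$ on and forever, $v$ is the only node whose leader flag is true, no other node has the own certificate of $v$, which is not nil, and the $ldr$ of every node is the own certificate of $v$. Then there is a constant $C>0$, depending only on $\varepsilon$ and $\xi$, such that for every connected network with $n>1$ nodes and $m$ links there is a $T$ with $$T\le C\,n^{4(2+\varepsilon)}\log^5 n$$ for which the following holds. At most $C\,n^{4(2+\varepsilon)}\,m\log^5 n$ messages are sent in the first $T$ rounds. Almost surely, each certificate broadcast before round $T$ consists of two integers of at most $C\log n$ bits. With probability at least $$1-\frac1{n^{\log(8/5)}}-2\xi,$$ explicit Revocable Leader Election is solved within $T$ rounds. -/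

import Mathlib

open MeasureTheory ProbabilityTheory

noncomputable section

namespace RevocableLE

/-! ### Parameters of the algorithm -/

/-- The two constants `ε`, `ξ` of the algorithm, with their admissible ranges. -/
structure Params where
  ε : ℝ
  ξ : ℝ
  ε_pos : 0 < ε
  ε_le_one : ε ≤ 1
  ξ_pos : 0 < ξ
  ξ_lt_one : ξ < 1

/-- The estimate of the network size in iteration `i = 0, 1, 2, …` of the main loop:
`k = 2, 4, 8, …`. -/
def est (i : ℕ) : ℕ := 2 ^ (i + 1)

namespace Params

variable (P : Params) (k : ℕ)

/-- `k ^ (1 + ε)`. -/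
def pw : ℝ := (k : ℝ) ^ (1 + P.ε)

/-- `r(k) = 2 k^(2(2+ε)) log (k^(2(1+ε))) + k^(1+ε) log (2k)`, logarithms to base 2. -/
def r : ℝ :=
  2 * (k : ℝ) ^ (2 * (2 + P.ε)) * Real.logb 2 ((k : ℝ) ^ (2 * (1 + P.ε)))
    + (k : ℝ) ^ (1 + P.ε) * Real.logb 2 (2 * (k : ℝ))

/-- `p(k) = ln 2 / k^(1+ε)`. -/
def p : ℝ := Real.log 2 / P.pw k

/-- `τ(k) = 1 - 1 / (k^(1+ε) - 1)`. -/
def τ : ℝ := 1 - 1 / (P.pw k - 1)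

/-- `f(k) = 4 √2 ln (k^(1+ε) / ξ) / (√2 - 1)²`. -/
def f : ℝ := 4 * √2 * Real.log (P.pw k / P.ξ) / (√2 - 1) ^ 2

/-- Number of passes through a loop "for `e = 1` to `f(k)`". -/
def execs : ℕ := ⌊P.f k⌋₊

/-- Number of passes through a loop "for `round = 1` to `r(k)`". -/
def diffRounds : ℕ := ⌊P.r k⌋₊

/-- Number of passes through a loop "for `round = 1` to `k^(1+ε)`". -/
def dissRounds : ℕ := ⌊P.pw k⌋₊

/-- Number of broadcasts in one execution of the certification procedure. -/
def numRounds : ℕ := P.diffRounds k + P.dissRounds k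

/-- The largest integer of the interval `[1, k^(4(1+ε)) log⁴(4k)]` from which IDs are drawn. -/
def idMax : ℕ := ⌊(k : ℝ) ^ (4 * (1 + P.ε)) * Real.logb 2 (4 * (k : ℝ)) ^ 4⌋₊

end Params

/-! ### Certificates, node states and messages -/

/-- A pair (estimate `K`, identifier `id`), or `⊥` for `nil`. The linear order says which of two
pairs wins the election: `nil` is below everything, a larger estimate wins, and for equal
estimates the smaller identifier wins. -/
abbrev Cert : Type := WithBot (ℕ ×ₗ ℕᵒᵈ)

/-- The certificate with estimate `K` and identifier `id`. -/
def mkCert (K id : ℕ) : Cert := ((toLex (K, OrderDual.toDual id) : ℕ ×ₗ ℕᵒᵈ) : Cert)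

/-- Local variables of a node. -/
structure NodeState where
  /-- `(K, id)` chosen by the node itself -/
  own : Cert
  /-- `(K_ldr, id_ldr)`, the leader from the viewpoint of the node -/
  ldr : Cert
  /-- the leader flag -/
  leader : Bool
  /-- number of `true` entries of the array `empty`, in the current iteration -/
  empties : ℕ
  /-- number of `probing` entries of the array `status`, in the current iteration -/
  probings : ℕ
  /-- the potential `Φ` -/
  pot : ℝ
  /-- the status `q`: `true` stands for `low`, `false` for `probing` -/
  low : Bool
  /-- the variable `c`: a white node has been detected -/
  white : Bool

/-- What a node broadcasts. The potential is transmitted in the diffusion phase only. -/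
structure Message where
  pot : ℝ
  low : Bool
  white : Bool
  ldr : Cert

namespace NodeState

/-- The values at the start of the algorithm. -/
def init : NodeState := ⟨⊥, ⊥, false, 0, 0, 0, false, false⟩

/-- The message broadcast by a node. -/
def msg (s : NodeState) : Message := ⟨s.pot, s.low, s.white, s.ldr⟩

/-- A new iteration of the main loop overwrites the arrays `empty` and `status`. -/
def beginIter (s : NodeState) : NodeState := { s with empties := 0, probings := 0 }

/-- Start of the certification procedure with the given colour (`true` is white). -/
def beginExec (isWhite : Bool) (s : NodeState) : NodeState :=
  { s with white := isWhite, low := false, pot := if isWhite then 0 else 1 }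

/-- One round of diffusion at a node that receives the messages `inbox` of its neighbours. -/
def diffuse (P : Params) (k : ℕ) (s : NodeState) (inbox : Multiset Message) : NodeState :=
  let ok : Prop := s.low = false ∧ (inbox.card : ℝ) ≤ P.pw k ∧ ∀ μ ∈ inbox, μ.low = false
  { s with
    pot := open Classical in
      if ok then
        s.pot + (inbox.map Message.pot).sum / (2 * P.pw k) - inbox.card * s.pot / (2 * P.pw k)
      else 1
    low := open Classical in if ok then s.low else true
    ldr := s.ldr ⊔ (inbox.map Message.ldr).sup }

/-- The comparison with the threshold `τ(k)` at the end of the diffusion phase. -/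
def threshold (P : Params) (k : ℕ) (s : NodeState) : NodeState :=
  if P.τ k < s.pot then { s with low := true, pot := 1 } else s

/-- One round of dissemination at a node that receives the messages `inbox`. -/
def disseminate (s : NodeState) (inbox : Multiset Message) : NodeState :=
  { s with
    low := open Classical in if ∃ μ ∈ inbox, μ.low = true then true else s.low
    white := open Classical in if ∃ μ ∈ inbox, μ.white = true then true else s.white
    ldr := s.ldr ⊔ (inbox.map Message.ldr).sup }

/-- The result of the certification procedure is recorded. -/
def endExec (s : NodeState) : NodeState :=
  { s with
    empties := s.empties + if s.white then 0 else 1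
    probings := s.probings + if s.low then 0 else 1 }

/-- The choice of an ID in the decision phase, `draw` being the random integer. -/
def choose (P : Params) (k draw : ℕ) (s : NodeState) : NodeState :=
  if s.own = ⊥ ∧ P.f k / 2 < (s.empties : ℝ) ∧ 0 < s.probings then
    { s with own := mkCert k draw, ldr := mkCert k draw }
  else s

/-- The update of the leader flag. -/
def updateFlag (s : NodeState) : NodeState := { s with leader := decide (s.ldr = s.own) }

/-- The decision phase. -/
def decision (P : Params) (k draw : ℕ) (s : NodeState) : NodeState :=
  (s.choose P k draw).updateFlag

end NodeState

/-! ### Executions on a network -/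

section Execution

variable {V : Type*} [Fintype V] (P : Params)
  (G : SimpleGraph V) [DecidableRel G.Adj]

/-- The local variables of all nodes. -/
abbrev Config (V : Type*) : Type _ := V → NodeState

/-- The messages that `v` receives when all its neighbours broadcast. -/
def inbox (s : Config V) (v : V) : Multiset Message :=
  (G.neighborFinset v).val.map fun u => (s u).msg

/-- The random choices: `colour (i, e, v)` tells whether node `v` is white in execution `e` of the
certification procedure in iteration `i`, and `draw (i, v)` is the integer which node `v` would
choose as its ID in iteration `i`. -/
abbrev Coins (V : Type*) : Type _ := (ℕ × ℕ × V → Bool) × (ℕ × V → ℕ)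

/-- The configuration after `j` rounds of the certification procedure started in `s`. The
threshold comparison is done directly after the last round of the diffusion phase. -/
def certify (k : ℕ) (s : Config V) (j : ℕ) : Config V :=
  if j < P.diffRounds k then
    (fun t v => (t v).diffuse P k (inbox G t v))^[j] s
  else
    (fun t v => (t v).disseminate (inbox G t v))^[j - P.diffRounds k]
      fun v =>
        ((fun t v => (t v).diffuse P k (inbox G t v))^[P.diffRounds k] s v).threshold P k

/-- Given the configuration `s` at the start of iteration `i`, the configuration after `e`
executions of the certification procedure. -/
def afterExecs (ω : Coins V) (i : ℕ) (s : Config V) : ℕ → Config V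
  | 0 => fun v => (s v).beginIter
  | e + 1 => fun v =>
      (certify P G (est i) (fun u => (afterExecs ω i s e u).beginExec (ω.1 (i, e, u)))
        (P.numRounds (est i)) v).endExec

/-- The configuration at the start of iteration `i` of the main loop. -/
def iterStart (ω : Coins V) : ℕ → Config V
  | 0 => fun _ => NodeState.init
  | i + 1 => fun v =>
      (afterExecs P G ω i (iterStart ω i) (P.execs (est i)) v).decision P (est i) (ω.2 (i, v))

/-- The configuration in iteration `i`, execution `e` of the certification procedure, after `j`
of its broadcasts have been completed; it lasts until the next broadcast is completed. -/
def configAt (ω : Coins V) (i e j : ℕ) : Config V :=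
  certify P G (est i)
    (fun u => (afterExecs P G ω i (iterStart P G ω i) e u).beginExec (ω.1 (i, e, u))) j

/-- `(i, e, j)` is a point that executions reach: broadcast number `j` (counted from `0`) of
execution `e` in iteration `i` exists. -/
def IsPoint (i e j : ℕ) : Prop := e < P.execs (est i) ∧ j < P.numRounds (est i)

/-! ### Time and messages -/

/-- Number of communication rounds used by broadcast number `j` (counted from `0`) of the
certification procedure. In the diffusion phase potentials are transmitted bit by bit, which takes
`(j + 1) log (2 k^(1+ε))` rounds; in the dissemination phase a broadcast takes one round. -/
def cost (k j : ℕ) : ℕ :=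
  if j < P.diffRounds k then ⌈((j : ℝ) + 1) * Real.logb 2 (2 * P.pw k)⌉₊ else 1

/-- Number of communication rounds used by the first `j` broadcasts of an execution of the
certification procedure. -/
def execTime (k j : ℕ) : ℕ := ∑ j' ∈ Finset.range j, cost P k j'

/-- Number of communication rounds completed when the point `(i, e, j)` is reached. -/
def elapsed (i e j : ℕ) : ℕ :=
  (∑ i' ∈ Finset.range i, P.execs (est i') * execTime P (est i') (P.numRounds (est i')))
    + e * execTime P (est i) (P.numRounds (est i)) + execTime P (est i) j

/-- Number of messages sent in the first `T` rounds: every node sends one message over each of its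
links in every round. -/
def messagesSent (T : ℕ) : ℕ := ∑ _t ∈ Finset.range T, ∑ v : V, G.degree v

/-! ### Explicit Revocable Leader Election -/

/-- In the configuration `s`, node `v` is the unique leader and all nodes know it: only `v` has its
flag raised, no other node has the certificate of `v`, and every node holds that certificate as
the one of the leader. -/
def Elected (s : Config V) (v : V) : Prop :=
  (∀ u, (s u).leader = true ↔ u = v) ∧ (s v).own ≠ ⊥ ∧
    (∀ u, (s u).own = (s v).own → u = v) ∧ ∀ u, (s u).ldr = (s v).own

/-- Within `T` rounds a unique leader has been elected, is known to all nodes, and stays so in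
every configuration from then on. -/
def SolvedWithin (ω : Coins V) (T : ℕ) : Prop :=
  ∃ v, ∀ i e j, IsPoint P i e j → T < elapsed P i e j + cost P (est i) j →
    Elected (configAt P G ω i e j) v

/-- Apart from potentials, the messages broadcast before round `T` have at most `B` bits in each
of their two entries `K_ldr`, `id_ldr` (the other entries are Boolean). -/
def MessagesFit (ω : Coins V) (T : ℕ) (B : ℝ) : Prop :=
  ∀ i e j, IsPoint P i e j → elapsed P i e j < T → ∀ v K id,
    (configAt P G ω i e j v).ldr = mkCert K id → (K.size : ℝ) ≤ B ∧ (id.size : ℝ) ≤ B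

end Execution

/-! ### The probability space -/

lemma est_pos (i : ℕ) : (1 : ℝ) ≤ est i := by
  unfold est
  exact_mod_cast Nat.one_le_two_pow

lemma one_le_pw (P : Params) (i : ℕ) : 1 ≤ P.pw (est i) :=
  Real.one_le_rpow (est_pos i) (by linarith [P.ε_pos])

lemma p_mem (P : Params) (i : ℕ) : P.p (est i) ∈ unitInterval := by
  have h := one_le_pw P i
  have h2 : Real.log 2 ≤ 1 := by linarith [Real.log_two_lt_d9]
  exact ⟨div_nonneg (Real.log_nonneg one_le_two) (by linarith),
    (div_le_one (by linarith)).2 (by linarith)⟩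

lemma one_le_idMax (P : Params) (i : ℕ) : 1 ≤ P.idMax (est i) := by
  have h := est_pos i
  have h1 : 1 ≤ (est i : ℝ) ^ (4 * (1 + P.ε)) :=
    Real.one_le_rpow h (by linarith [P.ε_pos])
  have h2 : 1 ≤ Real.logb 2 (4 * (est i : ℝ)) := by
    rw [Real.le_logb_iff_rpow_le one_lt_two (by linarith)]
    norm_num
    linarith
  refine Nat.le_floor ?_
  push_cast
  exact one_le_mul_of_one_le_of_one_le h1 (one_le_pow₀ h2)

/-- The law of a colour in iteration `i`: white (`true`) with probability `p(k)`. -/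
def colourLaw (P : Params) (i : ℕ) : Measure Bool :=
  bernoulliMeasure true false ⟨P.p (est i), p_mem P i⟩

/-- The law of an ID drawn in iteration `i`: uniform on `{1, …, idMax}`. -/
def drawLaw (P : Params) (i : ℕ) : Measure ℕ :=
  (PMF.uniformOfFinset (Finset.Icc 1 (P.idMax (est i)))
    (Finset.nonempty_Icc.2 (one_le_idMax P i))).toMeasure

instance (P : Params) (i : ℕ) : IsProbabilityMeasure (colourLaw P i) := by
  unfold colourLaw; infer_instance

instance (P : Params) (i : ℕ) : IsProbabilityMeasure (drawLaw P i) := by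
  unfold drawLaw; infer_instance

/-- The law of all random choices: they are independent. -/
def coinLaw (P : Params) (V : Type*) : Measure (Coins V) :=
  (Measure.infinitePi fun x : ℕ × ℕ × V => colourLaw P x.1).prod
    (Measure.infinitePi fun x : ℕ × V => drawLaw P x.1)

end RevocableLE

end

/-! Larger estimates win the election, so premature certificates are harmless as long as one
particular node waits. Write `K = k^(1+ε)`.

While `K ≤ n/2`, consider a node `c` of minimal eccentricity: its ball of radius `R` has at least
`min(n, 2R+1)` nodes (`exists_centre_card_ball`). Dissemination therefore shows `c` the colours of
at least `5K/3` nodes, an execution looks empty to `c` with probability at most `1/3`, and by a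
Chernoff bound `c` takes a certificate in that iteration with probability at most `ξ/K`. As `K` at
least doubles each time, these failures add up to at most `ξ` (`coinLaw_centre_le`,
`sum_div_pw_le`).

Let `i` be the first iteration with `K ≥ 2n`. Executions without a white node are then frequent
enough to pass the test on empty executions, and some execution has a white node, except with
probability below `ξ`. With a white node present, the potentials converge to a mean of at most `1 -
1/n`, by energy decay and a Poincaré inequality, so every node ends below the threshold and stays
probing (`avgStep_iterate_le`, `certify_low_eq_false`). Hence every node owns a certificate after
iteration `i`.

The largest certificate has an estimate at least that of `c`, so `K > n/2`. At most three iterations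
up to `i` qualify, and their IDs come from ranges of size at least `5n⁴`; ties have probability at
most `1/n` (`coinLaw_collision_le`), which is below `n^(-log(8/5))`. Iteration `i + 1` floods the
largest certificate and sets the flags for good (`elected_of_unique_max`), so `T` is the start of
iteration `i + 2`.

An iteration costs `O(n^(4(2+ε)) log⁴ n)` rounds: `O(log n)` executions, each quadratic in `r(k)`
with one more logarithm for the bits. There are `O(log n)` iterations. -/

noncomputable section

namespace RevocableLE

/-! ### Distances in connected graphs -/

section Distance

variable {V : Type*} {G : SimpleGraph V}

lemma dist_lt_card [Fintype V] (hG : G.Connected) (u v : V) : G.dist u v < Fintype.card V := by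
  obtain ⟨p, hp, hl⟩ := hG.exists_path_of_dist u v
  exact hl ▸ hp.length_lt

lemma abs_sub_le_sum_darts (x : V → ℝ) {a b : V} (p : G.Walk a b) :
    |x a - x b| ≤ (p.darts.map fun d => |x d.fst - x d.snd|).sum := by
  induction p with
  | nil => simp
  | @cons u v w h p ih =>
    simp only [SimpleGraph.Walk.darts_cons, List.map_cons, List.sum_cons]
    exact (abs_sub_le _ (x v) _).trans (by gcongr)

end Distance

/-! ### Spreading of maxima along the edges -/

section Spread

variable {V : Type*} [Fintype V] (G : SimpleGraph V) [DecidableRel G.Adj]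

/-- Every node takes the supremum of its own value and those of its neighbours. -/
def spread {α : Type*} [SemilatticeSup α] [OrderBot α] (l : V → α) (v : V) : α :=
  l v ⊔ (G.neighborFinset v).sup l

variable {G}

lemma le_spread_iterate_self {α : Type*} [SemilatticeSup α] [OrderBot α] (l : V → α) (j : ℕ)
    (v : V) : l v ≤ (spread G)^[j] l v := by
  induction j with
  | zero => exact le_rfl
  | succ j ih =>
    rw [Function.iterate_succ_apply']
    exact ih.trans le_sup_left

lemma le_spread_iterate_of_walk {α : Type*} [SemilatticeSup α] [OrderBot α] (l : V → α)
    {u v : V} (w : G.Walk v u) : ∀ j, w.length ≤ j → l u ≤ (spread G)^[j] l v := by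
  induction w with
  | nil => exact fun j _ => le_spread_iterate_self l j _
  | cons h p ih =>
    intro j hj
    obtain ⟨j, rfl⟩ : ∃ i, j = i + 1 := ⟨j - 1, by simp at hj; omega⟩
    rw [Function.iterate_succ_apply']
    refine (ih j (by simpa using hj)).trans (le_trans ?_ le_sup_right)
    exact Finset.le_sup (f := (spread G)^[j] l) (by simpa using h)

lemma le_spread_iterate {α : Type*} [SemilatticeSup α] [OrderBot α] (hG : G.Connected)
    (l : V → α) {u v : V} {j : ℕ} (h : G.dist v u ≤ j) : l u ≤ (spread G)^[j] l v := by
  obtain ⟨w, hw⟩ := hG.exists_walk_length_eq_dist v u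
  exact le_spread_iterate_of_walk l w j (hw.trans_le h)

/-- A finite supremum in a linear order is attained, so spreading only copies values and never
creates one. -/
lemma exists_spread_eq {α : Type*} [LinearOrder α] [OrderBot α] (l : V → α) (v : V) :
    ∃ u, spread G l v = l u := by
  unfold spread
  rcases (G.neighborFinset v).eq_empty_or_nonempty with h | h
  · exact ⟨v, by simp [h]⟩
  · obtain ⟨u, -, hu⟩ := Finset.exists_mem_eq_sup _ h l
    rw [hu]
    rcases le_total (l v) (l u) with h' | h'
    · exact ⟨u, sup_eq_right.2 h'⟩
    · exact ⟨v, sup_eq_left.2 h'⟩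

lemma exists_spread_iterate_eq {α : Type*} [LinearOrder α] [OrderBot α] (l : V → α) (j : ℕ)
    (v : V) : ∃ u, (spread G)^[j] l v = l u := by
  induction j generalizing v with
  | zero => exact ⟨v, rfl⟩
  | succ j ih =>
    rw [Function.iterate_succ_apply']
    obtain ⟨u, hu⟩ := exists_spread_eq (G := G) ((spread G)^[j] l) v
    rw [hu]
    exact ih u

lemma spread_iterate_eq_of_card_le {α : Type*} [LinearOrder α] [OrderBot α] (hG : G.Connected)
    (l : V → α) {a : α} (ha : ∀ u, l u ≤ a) (w : V) (hw : a ≤ l w) {j : ℕ}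
    (hj : Fintype.card V ≤ j) (v : V) : (spread G)^[j] l v = a := by
  apply le_antisymm
  · obtain ⟨u, hu⟩ := exists_spread_iterate_eq (G := G) l j v
    exact hu ▸ ha u
  · exact hw.trans (le_spread_iterate hG l ((dist_lt_card hG v w).le.trans hj))

end Spread

/-! ### Growth of balls around a centre -/

section Centre

variable {V : Type*} {G : SimpleGraph V}

lemma exists_dist_eq_of_le_dist (hG : G.Connected) {u v : V} {t : ℕ} (ht : t ≤ G.dist u v) :
    ∃ w, G.dist u w = t ∧ G.dist w v = G.dist u v - t := by
  obtain ⟨p, hp⟩ := hG.exists_walk_length_eq_dist u v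
  have h1 := G.dist_le (p.take t)
  have h2 := G.dist_le (p.drop t)
  rw [SimpleGraph.Walk.take_length] at h1
  rw [SimpleGraph.Walk.drop_length] at h2
  have h3 := hG.dist_triangle (u := u) (v := p.getVert t) (w := v)
  exact ⟨p.getVert t, by omega, by omega⟩

/-- A vertex of minimal eccentricity has at least two vertices at each positive distance below
its eccentricity. -/
lemma exists_centre [Fintype V] (hG : G.Connected) :
    ∃ c, ∀ R : ℕ, (∀ u, G.dist c u ≤ R) ∨
      ∀ t, 1 ≤ t → t ≤ R → ∃ a b, a ≠ b ∧ G.dist c a = t ∧ G.dist c b = t := by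
  have := hG.nonempty
  let ecc : V → ℕ := fun c => Finset.univ.sup fun u => G.dist c u
  obtain ⟨c, -, hc⟩ := Finset.exists_min_image Finset.univ ecc Finset.univ_nonempty
  obtain ⟨x, -, hx⟩ := Finset.exists_mem_eq_sup Finset.univ Finset.univ_nonempty
    fun u => G.dist c u
  have hle : ∀ u, G.dist c u ≤ G.dist c x := fun u => by
    rw [← hx]; exact Finset.le_sup (f := fun u => G.dist c u) (Finset.mem_univ u)
  refine ⟨c, fun R => ?_⟩
  by_cases hR : G.dist c x ≤ R
  · exact Or.inl fun u => (hle u).trans hR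
  right
  intro t ht1 htR
  -- `c'` is one step from `c` towards a farthest vertex `x`, and `y` is farthest from `c'`. The two
  -- vertices sought lie on a geodesic from `c'` to `x` and on one from `c` to `y`.
  obtain ⟨c', hc1, hc2⟩ := exists_dist_eq_of_le_dist hG (show 1 ≤ G.dist c x by omega)
  obtain ⟨y, -, hy⟩ := Finset.exists_mem_eq_sup Finset.univ Finset.univ_nonempty
    fun u => G.dist c' u
  have hcy : G.dist c x ≤ G.dist c' y := by
    have := hc c' (Finset.mem_univ _)
    simp only [ecc] at this
    rwa [hx, hy] at this
  have hc'c : G.dist c' c = 1 := by rw [SimpleGraph.dist_comm]; exact hc1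
  have h1 := hG.dist_triangle (u := c') (v := c) (w := y)
  obtain ⟨a, ha1, ha2⟩ := exists_dist_eq_of_le_dist hG (show t - 1 ≤ G.dist c' x by omega)
  obtain ⟨b, hb1, hb2⟩ := exists_dist_eq_of_le_dist hG (show t ≤ G.dist c y by omega)
  have h2 := hG.dist_triangle (u := c) (v := c') (w := a)
  have h3 := hG.dist_triangle (u := c) (v := a) (w := x)
  refine ⟨a, b, ?_, by omega, hb1⟩
  -- A common vertex would give `d(c', y) ≤ (t - 1) + (d(c, y) - t)`, less than the eccentricity of
  -- `c`, which is minimal.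
  rintro rfl
  have h4 := hG.dist_triangle (u := c') (v := a) (w := y)
  have h5 := hle y
  omega

open Classical in
/-- The ball of radius `R` as a finite set. -/
def ballFinset [Fintype V] (G : SimpleGraph V) (c : V) (R : ℕ) : Finset V :=
  Finset.univ.filter fun u => G.dist c u ≤ R

lemma exists_centre_card_ball [Fintype V] (hG : G.Connected) :
    ∃ c, ∀ R : ℕ, Fintype.card V ≤ (ballFinset G c R).card ∨
      2 * R + 1 ≤ (ballFinset G c R).card := by
  classical
  obtain ⟨c, hc⟩ := exists_centre hG
  refine ⟨c, fun R => ?_⟩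
  rcases hc R with h | h
  · left
    rw [ballFinset, Finset.filter_true_of_mem fun u _ => h u, Finset.card_univ]
  right
  have key : ∀ r ≤ R, 2 * r + 1 ≤ (ballFinset G c r).card := by
    intro r
    induction r with
    | zero =>
      intro _
      exact Finset.card_pos.2 ⟨c, by simp [ballFinset]⟩
    | succ r ih =>
      intro hr
      obtain ⟨a, b, hab, ha, hb⟩ := h (r + 1) (by omega) hr
      have h1 : Disjoint (ballFinset G c r) {a, b} := by
        rw [Finset.disjoint_right]
        intro z hz
        simp only [Finset.mem_insert, Finset.mem_singleton] at hz
        simp only [ballFinset, Finset.mem_filter, Finset.mem_univ, true_and, not_le]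
        rcases hz with rfl | rfl <;> omega
      have h2 : ballFinset G c r ∪ {a, b} ⊆ ballFinset G c (r + 1) := by
        intro z hz
        simp only [ballFinset, Finset.mem_union, Finset.mem_filter, Finset.mem_univ, true_and,
          Finset.mem_insert, Finset.mem_singleton] at hz ⊢
        rcases hz with hz | rfl | rfl <;> omega
      have h3 := Finset.card_le_card h2
      rw [Finset.card_union_of_disjoint h1, Finset.card_pair hab] at h3
      have := ih (by omega)
      omega
  exact key R le_rfl

end Centre

/-! ### Convergence of the potentials -/

section Diffusion

variable {V : Type*} [Fintype V] (G : SimpleGraph V) [DecidableRel G.Adj]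

/-- The linear part of a round of diffusion, `κ` being `2 k ^ (1 + ε)`. -/
def avgStep (κ : ℝ) (x : V → ℝ) (v : V) : ℝ :=
  x v + (∑ u ∈ G.neighborFinset v, x u) / κ - G.degree v * x v / κ

/-- Graph Laplacian. -/
def lap (x : V → ℝ) (v : V) : ℝ := ∑ u ∈ G.neighborFinset v, (x v - x u)

/-- The Dirichlet form, every edge being counted twice. -/
def dirichlet (x : V → ℝ) : ℝ := ∑ v, ∑ u ∈ G.neighborFinset v, (x v - x u) ^ 2

variable {G}

lemma avgStep_eq (κ : ℝ) (x : V → ℝ) (v : V) : avgStep G κ x v = x v - lap G x v / κ := by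
  simp only [avgStep, lap, Finset.sum_sub_distrib, Finset.sum_const, nsmul_eq_mul,
    SimpleGraph.card_neighborFinset_eq_degree]
  ring

lemma sum_neighbor_comm (F : V → V → ℝ) :
    ∑ v, ∑ u ∈ G.neighborFinset v, F v u = ∑ v, ∑ u ∈ G.neighborFinset v, F u v := by
  refine Finset.sum_comm' fun v u => ?_
  simp [G.adj_comm]

lemma sum_lap (x : V → ℝ) : ∑ v, lap G x v = 0 := by
  have h := sum_neighbor_comm (G := G) fun v u => x v - x u
  have h2 : ∑ v, ∑ u ∈ G.neighborFinset v, (x u - x v) = -∑ v, lap G x v := by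
    simp only [lap, ← Finset.sum_neg_distrib, neg_sub]
  simp only [lap] at h h2 ⊢
  linarith

lemma two_mul_sum_mul_lap (x : V → ℝ) : 2 * ∑ v, x v * lap G x v = dirichlet G x := by
  have h := sum_neighbor_comm (G := G) fun v u => x v * (x v - x u)
  simp only [lap, dirichlet, Finset.mul_sum] at h ⊢
  rw [← Finset.sum_congr rfl fun v _ => Finset.mul_sum _ _ _, ← Finset.mul_sum, two_mul]
  nth_rw 2 [h]
  rw [← Finset.sum_add_distrib]
  refine Finset.sum_congr rfl fun v _ => ?_
  rw [← Finset.sum_add_distrib]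
  exact Finset.sum_congr rfl fun u _ => by ring

lemma dirichlet_nonneg (x : V → ℝ) : 0 ≤ dirichlet G x :=
  Finset.sum_nonneg fun _ _ => Finset.sum_nonneg fun _ _ => sq_nonneg _

/-- Cauchy–Schwarz at each vertex, the degree being at most `n`. -/
lemma sum_lap_sq_le (x : V → ℝ) :
    ∑ v, lap G x v ^ 2 ≤ Fintype.card V * dirichlet G x := by
  rw [dirichlet, Finset.mul_sum]
  refine Finset.sum_le_sum fun v _ => ?_
  refine (sq_sum_le_card_mul_sum_sq (s := G.neighborFinset v)).trans ?_
  refine mul_le_mul_of_nonneg_right ?_ (Finset.sum_nonneg fun _ _ => sq_nonneg _)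
  exact_mod_cast Finset.card_le_univ _

/-- Cauchy–Schwarz along a path from `a` to `b`: it has fewer than `n` edges, and its darts are
distinct terms of the Dirichlet form. -/
lemma sq_sub_le_dirichlet (hG : G.Connected) (x : V → ℝ) (a b : V) :
    (x a - x b) ^ 2 ≤ Fintype.card V * dirichlet G x := by
  classical
  obtain ⟨p, hp, -⟩ := hG.exists_path_of_dist a b
  have hnd := SimpleGraph.Walk.darts_nodup_of_support_nodup hp.support_nodup
  have h1 := abs_sub_le_sum_darts x p
  rw [← List.sum_toFinset _ hnd] at h1
  have h2 := (sq_le_sq' (by linarith [abs_nonneg (x a - x b)]) h1).trans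
    (sq_sum_le_card_mul_sum_sq (s := p.darts.toFinset))
  rw [sq_abs] at h2
  refine h2.trans ?_
  have h3 : (p.darts.toFinset.card : ℝ) ≤ Fintype.card V := by
    rw [List.toFinset_card_of_nodup hnd, SimpleGraph.Walk.length_darts]
    exact_mod_cast hp.length_lt.le
  have h4 : ∑ d ∈ p.darts.toFinset, |x d.fst - x d.snd| ^ 2 ≤ dirichlet G x := by
    simp only [sq_abs, dirichlet]
    rw [Finset.sum_sigma']
    refine le_trans (le_of_eq ?_) (Finset.sum_le_sum_of_subset_of_nonneg
      (s := p.darts.toFinset.image fun d => (⟨d.fst, d.snd⟩ : (_ : V) × V)) ?_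
      fun _ _ _ => sq_nonneg _)
    · rw [Finset.sum_image]
      intro d _ d' _ h
      simp only [Sigma.mk.injEq, heq_eq_eq] at h
      exact SimpleGraph.Dart.ext _ _ (Prod.ext h.1 h.2)
    · intro z hz
      simp only [Finset.mem_image] at hz
      obtain ⟨d, -, rfl⟩ := hz
      simp [d.adj]
  have h5 : 0 ≤ ∑ d ∈ p.darts.toFinset, |x d.fst - x d.snd| ^ 2 :=
    Finset.sum_nonneg fun _ _ => sq_nonneg _
  exact mul_le_mul h3 h4 h5 (by positivity)

/-- Poincaré inequality. -/
lemma sum_sq_le_dirichlet (hG : G.Connected) {x : V → ℝ} (hx : ∑ v, x v = 0) :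
    ∑ v, x v ^ 2 ≤ (Fintype.card V : ℝ) ^ 2 * dirichlet G x := by
  have := hG.nonempty
  have hn : (0 : ℝ) < Fintype.card V := by exact_mod_cast Fintype.card_pos
  have h : ∑ a, ∑ b, (x a - x b) ^ 2 = 2 * Fintype.card V * ∑ v, x v ^ 2 := by
    have : ∀ a, ∑ b, (x a - x b) ^ 2 = Fintype.card V * x a ^ 2 + ∑ v, x v ^ 2 := by
      intro a
      simp only [sub_sq, Finset.sum_add_distrib, Finset.sum_sub_distrib, ← Finset.mul_sum, hx,
        Finset.sum_const, Finset.card_univ, nsmul_eq_mul]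
      ring
    simp only [this, Finset.sum_add_distrib, ← Finset.mul_sum, Finset.sum_const,
      Finset.card_univ, nsmul_eq_mul]
    ring
  have h2 : ∑ a : V, ∑ b : V, (x a - x b) ^ 2
      ≤ ∑ _a : V, ∑ _b : V, Fintype.card V * dirichlet G x :=
    Finset.sum_le_sum fun a _ => Finset.sum_le_sum fun b _ => sq_sub_le_dirichlet hG x a b
  simp only [Finset.sum_const, Finset.card_univ, nsmul_eq_mul] at h2
  -- Averaging over all pairs gives the constant `n²/2`; nonnegativity allows the factor `1/2` to be
  -- dropped.
  have h3 : 0 ≤ (Fintype.card V : ℝ) ^ 3 * dirichlet G x :=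
    mul_nonneg (by positivity) (dirichlet_nonneg x)
  have h4 : (Fintype.card V : ℝ) * ∑ v, x v ^ 2
      ≤ Fintype.card V * ((Fintype.card V : ℝ) ^ 2 * dirichlet G x) := by nlinarith
  exact le_of_mul_le_mul_left h4 hn

lemma sum_avgStep (κ : ℝ) (x : V → ℝ) : ∑ v, avgStep G κ x v = ∑ v, x v := by
  simp only [avgStep_eq, Finset.sum_sub_distrib, ← Finset.sum_div, sum_lap]
  simp

/-- Expanding the square gives `‖x‖² - D/κ + ‖Lx‖²/κ²`. Since `‖Lx‖² ≤ n D` and `κ ≥ 4n`, the last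
term returns at most a quarter of the loss `D/κ`; the Poincaré inequality turns the rest into a
fraction of `‖x‖²`. -/
lemma sum_sq_avgStep_le (hG : G.Connected) {κ : ℝ} (hκ : 4 * (Fintype.card V : ℝ) ≤ κ)
    {x : V → ℝ} (hx : ∑ v, x v = 0) :
    ∑ v, avgStep G κ x v ^ 2
      ≤ (1 - 3 / (4 * κ * (Fintype.card V : ℝ) ^ 2)) * ∑ v, x v ^ 2 := by
  have := hG.nonempty
  have hn : (0 : ℝ) < Fintype.card V := by exact_mod_cast Fintype.card_pos
  have hκ0 : 0 < κ := by linarith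
  have h1 : ∑ v, avgStep G κ x v ^ 2
      = ∑ v, x v ^ 2 - dirichlet G x / κ + (∑ v, lap G x v ^ 2) / κ ^ 2 := by
    rw [← two_mul_sum_mul_lap]
    simp only [avgStep_eq, Finset.mul_sum, Finset.sum_div, ← Finset.sum_sub_distrib,
      ← Finset.sum_add_distrib]
    refine Finset.sum_congr rfl fun v _ => ?_
    field_simp
    ring
  have h2 : (∑ v, lap G x v ^ 2) / κ ^ 2 ≤ dirichlet G x / κ * (1 / 4) := by
    rw [div_le_iff₀ (by positivity)]
    have : dirichlet G x / κ * (1 / 4) * κ ^ 2 = (κ / 4) * dirichlet G x := by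
      field_simp
    rw [this]
    exact (sum_lap_sq_le x).trans
      (mul_le_mul_of_nonneg_right (by linarith) (dirichlet_nonneg x))
  have h3 : 3 / (4 * κ * (Fintype.card V : ℝ) ^ 2) * ∑ v, x v ^ 2
      ≤ dirichlet G x / κ * (3 / 4) := by
    refine (mul_le_mul_of_nonneg_left (sum_sq_le_dirichlet hG hx) (by positivity)).trans
      (le_of_eq ?_)
    field_simp
  rw [h1, sub_mul, one_mul]
  linarith

lemma sum_sq_avgStep_iterate_le (hG : G.Connected) {κ : ℝ}
    (hκ : 4 * (Fintype.card V : ℝ) ≤ κ) {x : V → ℝ} (hx : ∑ v, x v = 0) (t : ℕ) :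
    ∑ v, (avgStep G κ)^[t] x v = 0 ∧ ∑ v, (avgStep G κ)^[t] x v ^ 2
      ≤ Real.exp (-(3 / (4 * κ * (Fintype.card V : ℝ) ^ 2) * t)) * ∑ v, x v ^ 2 := by
  induction t with
  | zero => simp [hx]
  | succ t ih =>
    simp only [Function.iterate_succ_apply']
    refine ⟨by rw [sum_avgStep, ih.1], ?_⟩
    set c := 3 / (4 * κ * (Fintype.card V : ℝ) ^ 2)
    have h1 := sum_sq_avgStep_le hG hκ ih.1
    have h2 : 0 ≤ ∑ v, (avgStep G κ)^[t] x v ^ 2 := Finset.sum_nonneg fun _ _ => sq_nonneg _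
    have h3 : 1 - c ≤ Real.exp (-c) := by linarith [Real.add_one_le_exp (-c)]
    calc _ ≤ _ := h1
      _ ≤ Real.exp (-c) * ∑ v, (avgStep G κ)^[t] x v ^ 2 := by gcongr
      _ ≤ Real.exp (-c) * (Real.exp (-(c * t)) * ∑ v, x v ^ 2) := by gcongr; exact ih.2
      _ = _ := by
        rw [← mul_assoc, ← Real.exp_add]
        push_cast
        ring_nf

lemma avgStep_sub_const (κ : ℝ) (x : V → ℝ) (a : ℝ) :
    avgStep G κ (fun v => x v - a) = fun v => avgStep G κ x v - a := by
  ext v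
  rw [avgStep_eq, avgStep_eq]
  simp only [lap, sub_sub_sub_cancel_right]
  ring

lemma avgStep_iterate_sub_const (κ : ℝ) (x : V → ℝ) (a : ℝ) (t : ℕ) :
    (avgStep G κ)^[t] (fun v => x v - a) = fun v => (avgStep G κ)^[t] x v - a := by
  induction t with
  | zero => rfl
  | succ t ih => simp only [Function.iterate_succ_apply', ih, avgStep_sub_const]

/-- Potentials that start in `[0, 1]`, one of them being `0`, are bounded away from `1` after
sufficiently many rounds. -/
lemma avgStep_iterate_le (hG : G.Connected) {κ : ℝ} (hκ : 4 * (Fintype.card V : ℝ) ≤ κ)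
    {x : V → ℝ} (hx0 : ∀ v, 0 ≤ x v) (hx1 : ∀ v, x v ≤ 1) (hw : ∃ w, x w = 0) {t : ℕ}
    (ht : Real.log (9 * (Fintype.card V : ℝ) ^ 3)
      ≤ 3 / (4 * κ * (Fintype.card V : ℝ) ^ 2) * t) (v : V) :
    (avgStep G κ)^[t] x v ≤ 1 - 2 / (3 * Fintype.card V) := by
  have := hG.nonempty
  have hn : (0 : ℝ) < Fintype.card V := by exact_mod_cast Fintype.card_pos
  set n : ℝ := (Fintype.card V : ℝ) with hndef
  set a : ℝ := (∑ v, x v) / n with ha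
  have ha0 : 0 ≤ a := div_nonneg (Finset.sum_nonneg fun v _ => hx0 v) hn.le
  have ha1 : a ≤ 1 - 1 / n := by
    obtain ⟨w, hw⟩ := hw
    have : ∑ v, x v ≤ n - 1 := by
      classical
      rw [← Finset.add_sum_erase _ _ (Finset.mem_univ w), hw, zero_add]
      refine (Finset.sum_le_sum fun v _ => hx1 v).trans (le_of_eq ?_)
      rw [Finset.sum_const, Finset.card_erase_of_mem (Finset.mem_univ w), Finset.card_univ,
        nsmul_eq_mul, mul_one, Nat.cast_sub Fintype.card_pos, Nat.cast_one]
    rw [ha, div_le_iff₀ hn]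
    field_simp
    linarith
  have ha1' : a ≤ 1 := ha1.trans (by have : 0 ≤ 1 / n := by positivity
                                     linarith)
  have hy : ∑ v, (x v - a) = 0 := by
    rw [Finset.sum_sub_distrib, Finset.sum_const, Finset.card_univ, nsmul_eq_mul, ha]
    field_simp
    ring
  have hE := (sum_sq_avgStep_iterate_le hG hκ hy t).2
  rw [avgStep_iterate_sub_const] at hE
  have hE0 : ∑ v, (x v - a) ^ 2 ≤ n := by
    refine (Finset.sum_le_sum (g := fun _ => (1 : ℝ)) fun v _ => ?_).trans (by simp [hndef])
    have := hx0 v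
    have := hx1 v
    nlinarith
  -- The energy about the mean is at most `n` at the start; the factor `1/(9n³)` brings it to
  -- `(1/(3n))²`, so every node is within `1/(3n)` of the mean.
  have h1 : Real.exp (-(3 / (4 * κ * n ^ 2) * t)) ≤ 1 / (9 * n ^ 3) := by
    rw [Real.exp_neg, one_div]
    refine inv_anti₀ (by positivity) ?_
    rw [← Real.exp_log (show 0 < 9 * n ^ 3 by positivity)]
    exact Real.exp_le_exp.2 ht
  have h2 : ((avgStep G κ)^[t] x v - a) ^ 2 ≤ (1 / (3 * n)) ^ 2 := by
    refine (Finset.single_le_sum (f := fun v => ((avgStep G κ)^[t] x v - a) ^ 2)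
      (fun _ _ => sq_nonneg _) (Finset.mem_univ v)).trans (hE.trans ?_)
    calc _ ≤ 1 / (9 * n ^ 3) * n :=
          mul_le_mul h1 hE0 (Finset.sum_nonneg fun _ _ => sq_nonneg _) (by positivity)
      _ = (1 / (3 * n)) ^ 2 := by field_simp; norm_num
  have h3 := abs_le_of_sq_le_sq h2 (by positivity)
  have h4 : 1 / n - 1 / (3 * n) = 2 / (3 * n) := by field_simp; norm_num
  linarith [(abs_le.1 h3).2]

end Diffusion

/-! ### Certificates -/

lemma mkCert_inj {K K' d d' : ℕ} (h : mkCert K d = mkCert K' d') : K = K' ∧ d = d' := by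
  simpa [mkCert] using h

lemma le_of_mkCert_le {K K' d d' : ℕ} (h : mkCert K d ≤ mkCert K' d') : K ≤ K' := by
  rw [mkCert, mkCert, WithBot.coe_le_coe, Prod.Lex.le_iff] at h
  rcases h with h | h
  · exact h.le
  · exact h.1.le

lemma est_strictMono : StrictMono est := fun _ _ h =>
  Nat.pow_lt_pow_right one_lt_two (Nat.succ_lt_succ h)

/-! ### One execution of the certification procedure -/

section Certify

variable {V : Type*} [Fintype V] (P : Params) (G : SimpleGraph V) [DecidableRel G.Adj]

/-- A round of diffusion at all nodes. -/
def diffRound (k : ℕ) (t : Config V) : Config V := fun v => (t v).diffuse P k (inbox G t v)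

/-- A round of dissemination at all nodes. -/
def dissRound (t : Config V) : Config V := fun v => (t v).disseminate (inbox G t v)

/-- The configuration after the diffusion phase and the threshold comparison. -/
def afterDiffusion (k : ℕ) (s : Config V) : Config V :=
  fun v => ((diffRound P G k)^[P.diffRounds k] s v).threshold P k

variable {P G} {k : ℕ}

lemma certify_of_lt {s : Config V} {j : ℕ} (h : j < P.diffRounds k) :
    certify P G k s j = (diffRound P G k)^[j] s := if_pos h

lemma certify_of_le {s : Config V} {j : ℕ} (h : P.diffRounds k ≤ j) :
    certify P G k s j = (dissRound G)^[j - P.diffRounds k] (afterDiffusion P G k s) :=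
  if_neg h.not_gt

lemma certify_numRounds (s : Config V) :
    certify P G k s (P.numRounds k) = (dissRound G)^[P.dissRounds k] (afterDiffusion P G k s) := by
  rw [Params.numRounds, certify_of_le (Nat.le_add_right _ _), Nat.add_sub_cancel_left]

/-- Meant for fields `F` that the round does not write, for which the hypothesis is `rfl`. -/
lemma diffRound_iterate_preserves {β : Type*} {F : NodeState → β}
    (h : ∀ s ib, F (NodeState.diffuse P k s ib) = F s) (s : Config V) (j : ℕ) (v : V) :
    F ((diffRound P G k)^[j] s v) = F (s v) := by
  induction j with
  | zero => rfl
  | succ j ih => rw [Function.iterate_succ_apply', ← ih]; exact h _ _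

lemma dissRound_iterate_preserves {β : Type*} {F : NodeState → β}
    (h : ∀ s ib, F (NodeState.disseminate s ib) = F s) (s : Config V) (j : ℕ) (v : V) :
    F ((dissRound G)^[j] s v) = F (s v) := by
  induction j with
  | zero => rfl
  | succ j ih => rw [Function.iterate_succ_apply', ← ih]; exact h _ _

lemma afterDiffusion_preserves {β : Type*} {F : NodeState → β}
    (h : ∀ s ib, F (NodeState.diffuse P k s ib) = F s)
    (h' : ∀ s : NodeState, F { s with low := true, pot := 1 } = F s) (s : Config V) (v : V) :
    F (afterDiffusion P G k s v) = F (s v) := by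
  rw [← diffRound_iterate_preserves (G := G) h s (P.diffRounds k) v, afterDiffusion, NodeState.threshold]
  split_ifs
  · exact h' _
  · rfl

lemma certify_preserves {β : Type*} {F : NodeState → β}
    (h : ∀ s ib, F (NodeState.diffuse P k s ib) = F s)
    (h' : ∀ s : NodeState, F { s with low := true, pot := 1 } = F s)
    (h'' : ∀ s ib, F (NodeState.disseminate s ib) = F s) (s : Config V) (j : ℕ) (v : V) :
    F (certify P G k s j v) = F (s v) := by
  rcases lt_or_ge j (P.diffRounds k) with hj | hj
  · rw [certify_of_lt hj, diffRound_iterate_preserves h]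
  · rw [certify_of_le hj, dissRound_iterate_preserves h'', afterDiffusion_preserves h h']

lemma certify_own (s : Config V) (j : ℕ) (v : V) : (certify P G k s j v).own = (s v).own :=
  certify_preserves (F := NodeState.own) (fun _ _ => rfl) (fun _ => rfl) (fun _ _ => rfl) s j v

lemma certify_leader (s : Config V) (j : ℕ) (v : V) :
    (certify P G k s j v).leader = (s v).leader :=
  certify_preserves (F := NodeState.leader) (fun _ _ => rfl) (fun _ => rfl) (fun _ _ => rfl) s j v

lemma certify_empties (s : Config V) (j : ℕ) (v : V) :
    (certify P G k s j v).empties = (s v).empties :=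
  certify_preserves (F := NodeState.empties) (fun _ _ => rfl) (fun _ => rfl) (fun _ _ => rfl) s j v

lemma certify_probings (s : Config V) (j : ℕ) (v : V) :
    (certify P G k s j v).probings = (s v).probings :=
  certify_preserves (F := NodeState.probings) (fun _ _ => rfl) (fun _ => rfl) (fun _ _ => rfl) s j v

lemma sup_inbox (s : Config V) (v : V) :
    ((inbox G s v).map Message.ldr).sup = (G.neighborFinset v).sup fun u => (s u).ldr := by
  rw [inbox, Multiset.map_map]
  rfl

lemma diffRound_iterate_ldr (s : Config V) (j : ℕ) :
    (fun v => ((diffRound P G k)^[j] s v).ldr) = (spread G)^[j] fun u => (s u).ldr := by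
  induction j with
  | zero => rfl
  | succ j ih =>
    rw [Function.iterate_succ_apply', Function.iterate_succ_apply', ← ih]
    ext1 v
    exact congrArg (_ ⊔ ·) (sup_inbox _ v)

lemma dissRound_iterate_ldr (s : Config V) (j : ℕ) :
    (fun v => ((dissRound G)^[j] s v).ldr) = (spread G)^[j] fun u => (s u).ldr := by
  induction j with
  | zero => rfl
  | succ j ih =>
    rw [Function.iterate_succ_apply', Function.iterate_succ_apply', ← ih]
    ext1 v
    exact congrArg (_ ⊔ ·) (sup_inbox _ v)

/-- Both phases update `ldr` in the same way and the threshold test leaves it alone, so the change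
of phase is invisible here. -/
lemma certify_ldr (s : Config V) (j : ℕ) (v : V) :
    (certify P G k s j v).ldr = (spread G)^[j] (fun u => (s u).ldr) v := by
  rcases lt_or_ge j (P.diffRounds k) with hj | hj
  · rw [certify_of_lt hj, ← diffRound_iterate_ldr]
  · rw [certify_of_le hj]
    have h1 : (fun v => (afterDiffusion P G k s v).ldr)
        = (spread G)^[P.diffRounds k] fun u => (s u).ldr := by
      rw [← diffRound_iterate_ldr (P := P) (k := k)]
      ext1 v
      rw [afterDiffusion, NodeState.threshold]
      split_ifs <;> rfl
    have h2 := dissRound_iterate_ldr (G := G) (afterDiffusion P G k s) (j - P.diffRounds k)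
    rw [h1, ← Function.iterate_add_apply, Nat.sub_add_cancel hj] at h2
    exact congrFun h2 v

/-- With `false < true`, a disjunction over the neighbours is a supremum, so the Boolean flags obey
the same spreading lemmas as the certificates. -/
lemma ite_inbox_eq_spread (f : Message → Bool) (s : Config V) (v : V) (b : Bool)
    (hb : b = f (s v).msg) [Decidable (∃ μ ∈ inbox G s v, f μ = true)] :
    (if ∃ μ ∈ inbox G s v, f μ = true then true else b)
      = spread G (fun u => f (s u).msg) v := by
  subst hb
  have h : (∃ μ ∈ inbox G s v, f μ = true) ↔
      (G.neighborFinset v).sup (fun u => f (s u).msg) = true := by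
    constructor
    · rintro ⟨μ, hμ, h⟩
      obtain ⟨u, hu, rfl⟩ := Multiset.mem_map.1 hμ
      have h1 := Finset.le_sup (f := fun u => f (s u).msg) (Finset.mem_def.2 hu)
      rw [h] at h1
      exact top_le_iff.1 h1
    · intro h
      rcases (G.neighborFinset v).eq_empty_or_nonempty with h' | h'
      · simp [h'] at h
      · obtain ⟨u, hu, h1⟩ := Finset.exists_mem_eq_sup _ h' fun u => f (s u).msg
        exact ⟨_, Multiset.mem_map_of_mem _ hu, h1.symm.trans h⟩
  rw [spread]
  split_ifs with h1
  · rw [h.1 h1]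
    exact (sup_top_eq _).symm
  · rw [h, Bool.not_eq_true] at h1
    rw [h1]
    exact (sup_bot_eq _).symm

lemma dissRound_iterate_white (s : Config V) (j : ℕ) :
    (fun v => ((dissRound G)^[j] s v).white) = (spread G)^[j] fun u => (s u).white := by
  induction j with
  | zero => rfl
  | succ j ih =>
    rw [Function.iterate_succ_apply', Function.iterate_succ_apply', ← ih]
    ext1 v
    classical exact ite_inbox_eq_spread Message.white _ v _ rfl

lemma dissRound_iterate_low (s : Config V) (j : ℕ) :
    (fun v => ((dissRound G)^[j] s v).low) = (spread G)^[j] fun u => (s u).low := by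
  induction j with
  | zero => rfl
  | succ j ih =>
    rw [Function.iterate_succ_apply', Function.iterate_succ_apply', ← ih]
    ext1 v
    classical exact ite_inbox_eq_spread Message.low _ v _ rfl

/-- Diffusion does not propagate `c`; hence the colours travel only as far as the dissemination
phase lasts. -/
lemma certify_white (s : Config V) (v : V) :
    (certify P G k s (P.numRounds k) v).white
      = (spread G)^[P.dissRounds k] (fun u => (s u).white) v := by
  rw [certify_numRounds]
  have h := congrFun (dissRound_iterate_white (G := G) (afterDiffusion P G k s)
    (P.dissRounds k)) v
  simp only [afterDiffusion_preserves (F := NodeState.white) (fun _ _ => rfl) (fun _ => rfl)] at h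
  exact h

lemma certify_white_eq_false {s : Config V} (h : ∀ u, (s u).white = false) (v : V) :
    (certify P G k s (P.numRounds k) v).white = false := by
  rw [certify_white]
  obtain ⟨u, hu⟩ := exists_spread_iterate_eq (G := G) (fun u => (s u).white) (P.dissRounds k) v
  rw [hu, h]

lemma certify_white_eq_true (hG : G.Connected) {s : Config V} {u v : V}
    (h : (s u).white = true) (hd : G.dist v u ≤ P.dissRounds k) :
    (certify P G k s (P.numRounds k) v).white = true := by
  rw [certify_white]
  have := le_spread_iterate hG (fun u => (s u).white) hd
  simp only [h] at this
  exact top_le_iff.1 this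

/-- The two claims need a joint induction: a round is the linear averaging only where nobody is low,
and the degree bound keeps everybody from becoming low. -/
lemma diffRound_iterate_pot (hdeg : ∀ v, (G.degree v : ℝ) ≤ P.pw k) {s : Config V}
    (hs : ∀ v, (s v).low = false) (j : ℕ) :
    (∀ v, ((diffRound P G k)^[j] s v).low = false) ∧
      (fun v => ((diffRound P G k)^[j] s v).pot)
        = (avgStep G (2 * P.pw k))^[j] fun v => (s v).pot := by
  induction j with
  | zero => exact ⟨hs, rfl⟩
  | succ j ih =>
    set t := (diffRound P G k)^[j] s
    have hcard : ∀ v, (inbox G t v).card = G.degree v := fun v => by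
      rw [inbox, Multiset.card_map]; rfl
    have hok : ∀ v, (t v).low = false ∧ ((inbox G t v).card : ℝ) ≤ P.pw k ∧
        ∀ μ ∈ inbox G t v, μ.low = false := by
      refine fun v => ⟨ih.1 v, by rw [hcard]; exact hdeg v, fun μ hμ => ?_⟩
      obtain ⟨u, -, rfl⟩ := Multiset.mem_map.1 hμ
      exact ih.1 u
    simp only [Function.iterate_succ_apply', ← ih.2]
    refine ⟨fun v => ?_, funext fun v => ?_⟩
    · simp only [diffRound, NodeState.diffuse]
      rw [if_pos (hok v)]
      exact ih.1 v
    · simp only [diffRound, NodeState.diffuse]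
      rw [if_pos (hok v), hcard, avgStep, inbox, Multiset.map_map]
      rfl

/-- If the estimate is large and some node is white, all nodes remain probing. -/
lemma certify_low_eq_false (hG : G.Connected) (hn : 1 < Fintype.card V)
    (hK : 2 * (Fintype.card V : ℝ) ≤ P.pw k)
    (hr : Real.log (9 * (Fintype.card V : ℝ) ^ 3)
      ≤ 3 / (4 * (2 * P.pw k) * (Fintype.card V : ℝ) ^ 2) * P.diffRounds k)
    {s : Config V} (hlow : ∀ v, (s v).low = false)
    (hpot : ∀ v, (s v).pot = if (s v).white then 0 else 1) (hw : ∃ w, (s w).white = true)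
    (v : V) : (certify P G k s (P.numRounds k) v).low = false := by
  have hn' : (2 : ℝ) ≤ Fintype.card V := by exact_mod_cast hn
  have hdeg : ∀ v, (G.degree v : ℝ) ≤ P.pw k := fun v => by
    have : (G.degree v : ℝ) ≤ Fintype.card V := by exact_mod_cast (G.degree_lt_card_verts v).le
    linarith
  obtain ⟨h1, h2⟩ := diffRound_iterate_pot hdeg hlow (P.diffRounds k)
  have h3 : ∀ v, ((diffRound P G k)^[P.diffRounds k] s v).pot
      ≤ 1 - 2 / (3 * Fintype.card V) := by
    intro v
    refine (congrFun h2 v).trans_le ?_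
    refine avgStep_iterate_le hG (by linarith) (fun v => ?_) (fun v => ?_) ?_ hr v
    · rw [hpot]; split_ifs <;> norm_num
    · rw [hpot]; split_ifs <;> norm_num
    · obtain ⟨w, hw⟩ := hw
      exact ⟨w, by rw [hpot, hw]; rfl⟩
  have h4 : ∀ v, (afterDiffusion P G k s v).low = false := by
    intro v
    rw [afterDiffusion, NodeState.threshold, if_neg, h1]
    rw [not_lt]
    refine (h3 v).trans ?_
    -- As `K ≥ 2n`, it suffices that `1/(2n - 1) ≤ 2/(3n)`, which is `n ≥ 2`.
    rw [Params.τ]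
    refine sub_le_sub_left ?_ 1
    rw [div_le_div_iff₀ (by linarith) (by linarith)]
    linarith
  rw [certify_numRounds]
  have h5 := congrFun (dissRound_iterate_low (G := G) (afterDiffusion P G k s)
    (P.dissRounds k)) v
  simp only [h4] at h5
  rw [h5]
  obtain ⟨u, hu⟩ := exists_spread_iterate_eq (G := G) (fun _ : V => false) (P.dissRounds k) v
  exact hu

end Certify

section Iterations

variable {V : Type*} [Fintype V] {P : Params} {G : SimpleGraph V} [DecidableRel G.Adj]
  {ω : Coins V} {i : ℕ}

/-! ### The iterations of the main loop -/

lemma configAt_ldr (e j : ℕ) (v : V) : (configAt P G ω i e j v).ldr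
    = (spread G)^[j] (fun u => (afterExecs P G ω i (iterStart P G ω i) e u).ldr) v :=
  certify_ldr _ j v

lemma afterExecs_own (s : Config V) (e : ℕ) (v : V) :
    (afterExecs P G ω i s e v).own = (s v).own := by
  induction e with
  | zero => rfl
  | succ e ih => exact (certify_own _ _ v).trans ih

lemma afterExecs_leader (s : Config V) (e : ℕ) (v : V) :
    (afterExecs P G ω i s e v).leader = (s v).leader := by
  induction e with
  | zero => rfl
  | succ e ih => exact (certify_leader _ _ v).trans ih

lemma configAt_own (e j : ℕ) (v : V) :
    (configAt P G ω i e j v).own = (iterStart P G ω i v).own :=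
  (certify_own _ j v).trans (afterExecs_own _ e v)

lemma configAt_leader (e j : ℕ) (v : V) :
    (configAt P G ω i e j v).leader = (iterStart P G ω i v).leader :=
  (certify_leader _ j v).trans (afterExecs_leader _ e v)

lemma afterExecs_succ_ldr (s : Config V) (e : ℕ) (v : V) :
    (afterExecs P G ω i s (e + 1) v).ldr
      = (spread G)^[P.numRounds (est i)] (fun u => (afterExecs P G ω i s e u).ldr) v :=
  certify_ldr _ _ v

lemma le_afterExecs_ldr (s : Config V) (e : ℕ) (v : V) :
    (s v).ldr ≤ (afterExecs P G ω i s e v).ldr := by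
  induction e with
  | zero => exact le_rfl
  | succ e ih =>
    rw [afterExecs_succ_ldr]
    exact ih.trans (le_spread_iterate_self (G := G)
      (fun u => (afterExecs P G ω i s e u).ldr) _ v)

lemma exists_afterExecs_ldr_eq (s : Config V) (e : ℕ) (v : V) :
    ∃ u, (afterExecs P G ω i s e v).ldr = (s u).ldr := by
  induction e generalizing v with
  | zero => exact ⟨v, rfl⟩
  | succ e ih =>
    rw [afterExecs_succ_ldr]
    obtain ⟨u, hu⟩ := exists_spread_iterate_eq (G := G)
      (fun u => (afterExecs P G ω i s e u).ldr) (P.numRounds (est i)) v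
    rw [hu]
    exact ih u

variable (ω i)

/-- No node of `S` is white in execution `e` of iteration `i`. -/
def Quiet (S : Finset V) (e : ℕ) : Prop := ∀ u ∈ S, ω.1 (i, e, u) = false

open Classical in
/-- The number of executions of iteration `i` in which no node of `S` is white. -/
def quietCount (P : Params) (S : Finset V) : ℕ :=
  ((Finset.range (P.execs (est i))).filter (Quiet ω i S)).card

variable {ω i}

open Classical in
-- Together with `afterExecs_empties_le` this sandwiches a quantity of the algorithm between counts
-- that depend on the colours alone: no white node anywhere is noticed by all as empty, while a
-- white node in the ball around `v` reaches `v`.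
lemma le_afterExecs_empties (s : Config V) (e : ℕ) (v : V) :
    ((Finset.range e).filter (Quiet ω i Finset.univ)).card
      ≤ (afterExecs P G ω i s e v).empties := by
  induction e with
  | zero => simp
  | succ e ih =>
    simp only [afterExecs, NodeState.endExec, certify_empties]
    rw [Finset.range_add_one, Finset.filter_insert]
    split_ifs with h1 h2 h2
    · rw [certify_white_eq_false] at h2
      · exact absurd h2 (by simp)
      · exact fun u => h1 u (Finset.mem_univ u)
    · rw [Finset.card_insert_of_notMem (by simp)]
      exact Nat.add_le_add_right ih 1
    · exact ih
    · exact ih.trans (Nat.le_add_right _ _)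

open Classical in
lemma afterExecs_empties_le (hG : G.Connected) (s : Config V) (e : ℕ) (v : V) :
    (afterExecs P G ω i s e v).empties ≤
      ((Finset.range e).filter (Quiet ω i (ballFinset G v (P.dissRounds (est i))))).card := by
  induction e with
  | zero => simp [afterExecs, NodeState.beginIter]
  | succ e ih =>
    simp only [afterExecs, NodeState.endExec, certify_empties]
    rw [Finset.range_add_one, Finset.filter_insert]
    split_ifs with h1 h2 h2
    · rw [Finset.card_insert_of_notMem (by simp)]
      exact ih.trans (Nat.le_add_right _ _)
    · exact ih
    · rw [Finset.card_insert_of_notMem (by simp)]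
      exact Nat.add_le_add_right ih 1
    · refine absurd ?_ h1
      simp only [Quiet, not_forall, Bool.not_eq_false] at h2
      obtain ⟨u, hu, h2⟩ := h2
      exact certify_white_eq_true hG (u := u) h2 (by simpa [ballFinset] using hu)

/-- The number of rounds of diffusion suffices for convergence of the potentials. -/
def Mixing (P : Params) (n k : ℕ) : Prop :=
  2 * (n : ℝ) ≤ P.pw k ∧
    Real.log (9 * (n : ℝ) ^ 3) ≤ 3 / (4 * (2 * P.pw k) * (n : ℝ) ^ 2) * P.diffRounds k

/-- A single execution with a white node suffices, because all nodes end that execution probing. -/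
lemma afterExecs_probings_pos (hG : G.Connected) (hn : 1 < Fintype.card V)
    (hmix : Mixing P (Fintype.card V) (est i)) (s : Config V) {e e' : ℕ} (he : e' < e)
    (hq : ¬ Quiet ω i Finset.univ e') (v : V) :
    0 < (afterExecs P G ω i s e v).probings := by
  induction e with
  | zero => simp at he
  | succ e ih =>
    simp only [afterExecs, NodeState.endExec, certify_probings]
    rcases (Nat.lt_succ_iff_lt_or_eq.1 he) with h | rfl
    · exact (ih h).trans_le (Nat.le_add_right _ _)
    · rw [certify_low_eq_false hG hn hmix.1 hmix.2]
      · simp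
      · exact fun v => rfl
      · exact fun v => rfl
      · simpa [Quiet, NodeState.beginExec] using hq

/-! ### The decision phase -/

/-- The two branches of the decision. Of the conditions for a draw, the count of `probing` entries
is dropped: only the count of empty executions is needed to exclude early certificates. -/
lemma iterStart_succ_own (v : V) :
    ((iterStart P G ω (i + 1) v).own = (iterStart P G ω i v).own ∧
      (iterStart P G ω (i + 1) v).ldr
        = (afterExecs P G ω i (iterStart P G ω i) (P.execs (est i)) v).ldr) ∨
    ((iterStart P G ω i v).own = ⊥ ∧
      P.f (est i) / 2
        < (afterExecs P G ω i (iterStart P G ω i) (P.execs (est i)) v).empties ∧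
      (iterStart P G ω (i + 1) v).own = mkCert (est i) (ω.2 (i, v)) ∧
      (iterStart P G ω (i + 1) v).ldr = mkCert (est i) (ω.2 (i, v))) := by
  simp only [iterStart, NodeState.decision, NodeState.updateFlag, NodeState.choose,
    afterExecs_own]
  split_ifs with h
  · exact Or.inr ⟨h.1, h.2.1, rfl, rfl⟩
  · exact Or.inl ⟨afterExecs_own _ _ v, rfl⟩

lemma iterStart_succ_own_of_ne {v : V} (h : (iterStart P G ω i v).own ≠ ⊥) :
    (iterStart P G ω (i + 1) v).own = (iterStart P G ω i v).own ∧
      (iterStart P G ω (i + 1) v).ldr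
        = (afterExecs P G ω i (iterStart P G ω i) (P.execs (est i)) v).ldr := by
  rcases iterStart_succ_own (P := P) (G := G) (ω := ω) (i := i) v with h' | h'
  · exact h'
  · exact absurd h'.1 h

lemma iterStart_succ_leader (v : V) : (iterStart P G ω (i + 1) v).leader
    = decide ((iterStart P G ω (i + 1) v).ldr = (iterStart P G ω (i + 1) v).own) := rfl

lemma iterStart_succ_own_ne_bot (hG : G.Connected) (hn : 1 < Fintype.card V)
    (hmix : Mixing P (Fintype.card V) (est i))
    (hc : P.f (est i) / 2 < quietCount ω i P Finset.univ)
    (hq : ∃ e < P.execs (est i), ¬ Quiet ω i Finset.univ e) (v : V) :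
    (iterStart P G ω (i + 1) v).own ≠ ⊥ := by
  obtain ⟨e, he, hq⟩ := hq
  by_cases h : (iterStart P G ω i v).own = ⊥
  · simp only [iterStart, NodeState.decision, NodeState.updateFlag, NodeState.choose,
      afterExecs_own]
    rw [if_pos ⟨h, hc.trans_le (by exact_mod_cast le_afterExecs_empties _ _ v),
      afterExecs_probings_pos hG hn hmix _ he hq v⟩]
    exact WithBot.coe_ne_bot
  · rwa [(iterStart_succ_own_of_ne h).1]

/-- The possible values of the certificates of the nodes. -/
lemma iterStart_own_eq (hG : G.Connected) (v : V) : (iterStart P G ω i v).own = ⊥ ∨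
    ∃ i' < i, (iterStart P G ω i v).own = mkCert (est i') (ω.2 (i', v)) ∧
      P.f (est i') / 2 < quietCount ω i' P (ballFinset G v (P.dissRounds (est i'))) := by
  induction i with
  | zero => exact Or.inl rfl
  | succ i ih =>
    rcases iterStart_succ_own (P := P) (G := G) (ω := ω) (i := i) v with h | h
    · rw [h.1]
      refine ih.imp_right fun ⟨i', h1, h2⟩ => ⟨i', by omega, h2⟩
    · refine Or.inr ⟨i, i.lt_succ_self, h.2.2.1, h.2.1.trans_le ?_⟩
      exact_mod_cast afterExecs_empties_le hG _ _ v

lemma iterStart_own_le_ldr (v : V) :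
    (iterStart P G ω i v).own ≤ (iterStart P G ω i v).ldr := by
  induction i with
  | zero => exact le_rfl
  | succ i ih =>
    rcases iterStart_succ_own (P := P) (G := G) (ω := ω) (i := i) v with h | h
    · rw [h.1, h.2]
      exact ih.trans (le_afterExecs_ldr _ _ v)
    · rw [h.2.2.1, h.2.2.2]

/-- Values of `ldr` are copies of own certificates, and own certificates are never replaced. With
`iterStart_own_le_ldr`, the largest `ldr` is thus the largest own certificate. -/
lemma iterStart_ldr_eq (v : V) : (iterStart P G ω i v).ldr = ⊥ ∨
    ∃ u, (iterStart P G ω i v).ldr = (iterStart P G ω i u).own := by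
  induction i generalizing v with
  | zero => exact Or.inl rfl
  | succ i ih =>
    rcases iterStart_succ_own (P := P) (G := G) (ω := ω) (i := i) v with h | h
    · rw [h.2]
      obtain ⟨u, hu⟩ := exists_afterExecs_ldr_eq (P := P) (G := G) (ω := ω) (i := i)
        (iterStart P G ω i) (P.execs (est i)) v
      rw [hu]
      by_cases hbot : (iterStart P G ω i u).ldr = ⊥
      · exact Or.inl hbot
      · obtain ⟨w, hw⟩ := (ih u).resolve_left hbot
        refine Or.inr ⟨w, hw.trans (iterStart_succ_own_of_ne ?_).1.symm⟩
        rwa [← hw]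
    · exact Or.inr ⟨v, h.2.2.2.trans h.2.2.1.symm⟩

lemma configAt_ldr_eq (hG : G.Connected) (e j : ℕ) (v : V) :
    (configAt P G ω i e j v).ldr = ⊥ ∨
      ∃ i' < i, ∃ u, (configAt P G ω i e j v).ldr = mkCert (est i') (ω.2 (i', u)) := by
  rw [configAt_ldr]
  obtain ⟨u, hu⟩ := exists_spread_iterate_eq (G := G)
    (fun u => (afterExecs P G ω i (iterStart P G ω i) e u).ldr) j v
  obtain ⟨u', hu'⟩ := exists_afterExecs_ldr_eq (P := P) (G := G) (ω := ω) (i := i)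
        (iterStart P G ω i) e u
  rw [hu, hu']
  rcases iterStart_ldr_eq (P := P) (G := G) (ω := ω) (i := i) u' with h | ⟨w, h⟩
  · exact Or.inl h
  · rw [h]
    exact (iterStart_own_eq hG w).imp_right fun ⟨i', h1, h2, _⟩ => ⟨i', h1, w, h2⟩

/-! ### Stabilisation -/

/-- Once all nodes own certificates, nobody draws again. Iteration `i` floods the maximum and sets
the flags at its end; afterwards spreading a constant changes nothing. The flags are right only from
then on, hence `i < i'`. -/
lemma elected_of_unique_max (hG : G.Connected)
    (hall : ∀ v, (iterStart P G ω i v).own ≠ ⊥) {w : V}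
    (hmax : ∀ u, (iterStart P G ω i u).own ≤ (iterStart P G ω i w).own)
    (huniq : ∀ u, (iterStart P G ω i u).own = (iterStart P G ω i w).own → u = w)
    (hrounds : Fintype.card V ≤ P.numRounds (est i)) (hexecs : 0 < P.execs (est i))
    {i' : ℕ} (hi' : i < i') (e j : ℕ) : Elected (configAt P G ω i' e j) w := by
  set M := (iterStart P G ω i w).own with hM
  have hown : ∀ d v, (iterStart P G ω (i + d) v).own = (iterStart P G ω i v).own := by
    intro d v
    induction d with
    | zero => rfl
    | succ d ih =>
      rw [← ih]
      exact (iterStart_succ_own_of_ne (i := i + d) (by rw [ih]; exact hall v)).1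
  have hconst : ∀ (l : V → Cert), (∀ v, l v = M) → ∀ j v, (spread G)^[j] l v = M := by
    intro l hl j v
    obtain ⟨u, hu⟩ := exists_spread_iterate_eq (G := G) l j v
    rw [hu, hl]
  have hexec : ∀ i s, (∀ v, (s v).ldr = M) → ∀ e v, (afterExecs P G ω i s e v).ldr = M := by
    intro i s hs e v
    obtain ⟨u, hu⟩ := exists_afterExecs_ldr_eq (P := P) (G := G) (ω := ω) (i := i) s e v
    rw [hu, hs]
  -- One execution has at least `n` broadcasts, so the maximum reaches all nodes during the first
  -- one.
  have hfirst : ∀ e v, (afterExecs P G ω i (iterStart P G ω i) (e + 1) v).ldr = M := by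
    intro e v
    rw [afterExecs_succ_ldr]
    refine spread_iterate_eq_of_card_le hG _ (fun u => ?_) w ?_ hrounds v
    · obtain ⟨x, hx⟩ := exists_afterExecs_ldr_eq (P := P) (G := G) (ω := ω) (i := i)
        (iterStart P G ω i) e u
      rw [hx]
      rcases iterStart_ldr_eq (P := P) (G := G) (ω := ω) (i := i) x with h | ⟨y, h⟩
      · rw [h]; exact bot_le
      · rw [h]; exact hmax y
    · exact (iterStart_own_le_ldr w).trans (le_afterExecs_ldr _ _ w)
  have hldr : ∀ d v, (iterStart P G ω (i + 1 + d) v).ldr = M := by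
    intro d
    induction d with
    | zero =>
      intro v
      rw [Nat.add_zero, (iterStart_succ_own_of_ne (hall v)).2]
      obtain ⟨e, he⟩ := Nat.exists_eq_add_of_lt hexecs
      rw [he, Nat.zero_add]
      exact hfirst e v
    | succ d ih =>
      intro v
      have h1 : (iterStart P G ω (i + 1 + d) v).own ≠ ⊥ := by
        rw [Nat.add_assoc, hown]; exact hall v
      rw [← Nat.add_assoc, (iterStart_succ_own_of_ne h1).2]
      exact hexec _ _ ih _ v
  obtain ⟨d, rfl⟩ := Nat.exists_eq_add_of_lt hi'
  have hown' : ∀ u, (configAt P G ω (i + d + 1) e j u).own = (iterStart P G ω i u).own :=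
    fun u => by rw [configAt_own, Nat.add_assoc, hown]
  have hldr' : ∀ u, (iterStart P G ω (i + d + 1) u).ldr = M := by
    rw [show i + d + 1 = i + 1 + d by omega]; exact hldr d
  refine ⟨fun u => ?_, by rw [hown']; exact hall w, fun u hu => ?_, fun u => ?_⟩
  · rw [configAt_leader, iterStart_succ_leader, hldr', decide_eq_true_iff, Nat.add_assoc, hown]
    exact ⟨fun h => huniq u h.symm, fun h => by rw [h]⟩
  · rw [hown', hown'] at hu
    exact huniq u hu
  · rw [hown', configAt_ldr]
    exact hconst _ (fun v => hexec _ _ hldr' e v) j u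

end Iterations

/-! ### Exponential moments of the number of successes -/

open Classical in
-- Write `s^N` as a product of factors `1 + (s - 1) 1_A` and expand over subsets. Expectations then
-- involve only probabilities of intersections.
lemma pow_card_filter_eq_sum {Ω : Type*} (A : ℕ → Set Ω) (E : ℕ) (s : ℝ) (ω : Ω) :
    s ^ ((Finset.range E).filter fun e => ω ∈ A e).card
      = ∑ F ∈ (Finset.range E).powerset,
          (⋂ e ∈ F, A e).indicator (fun _ => (s - 1) ^ F.card) ω := by
  have h : s ^ ((Finset.range E).filter fun e => ω ∈ A e).card
      = ∏ e ∈ Finset.range E, (1 + if ω ∈ A e then s - 1 else 0) := by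
    rw [← Finset.prod_const, Finset.prod_filter]
    refine Finset.prod_congr rfl fun e _ => ?_
    split_ifs <;> ring
  rw [h, Finset.prod_one_add]
  refine Finset.sum_congr rfl fun F _ => ?_
  by_cases hF : ∀ e ∈ F, ω ∈ A e
  · rw [Set.indicator_of_mem (by simpa using hF), ← Finset.prod_const]
    exact Finset.prod_congr rfl fun e he => if_pos (hF e he)
  · rw [Set.indicator_of_notMem (by simpa using hF)]
    push Not at hF
    obtain ⟨e, he, h⟩ := hF
    exact Finset.prod_eq_zero he (if_neg h)

section Moment

variable {Ω : Type*} [MeasurableSpace Ω] {μ : Measure Ω} [IsProbabilityMeasure μ]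
  {A : ℕ → Set Ω} {E : ℕ} {q : ℝ}

open Classical in
lemma integral_pow_card_filter (hA : ∀ e, MeasurableSet (A e))
    (h : ∀ F ⊆ Finset.range E, μ.real (⋂ e ∈ F, A e) = q ^ F.card) (s : ℝ) :
    Integrable (fun ω => s ^ ((Finset.range E).filter fun e => ω ∈ A e).card) μ ∧
      ∫ ω, s ^ ((Finset.range E).filter fun e => ω ∈ A e).card ∂μ = (1 + (s - 1) * q) ^ E := by
  have hm : ∀ F : Finset ℕ, MeasurableSet (⋂ e ∈ F, A e) := fun F =>
    F.measurableSet_biInter fun e _ => hA e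
  have hint : ∀ F ∈ (Finset.range E).powerset,
      Integrable ((⋂ e ∈ F, A e).indicator fun _ => (s - 1) ^ F.card) μ :=
    fun F _ => (integrable_const _).indicator (hm F)
  simp only [pow_card_filter_eq_sum]
  refine ⟨integrable_finsetSum _ hint, ?_⟩
  rw [integral_finsetSum _ hint]
  have h1 : (1 + (s - 1) * q) ^ E = ∏ _e ∈ Finset.range E, (1 + (s - 1) * q) := by simp
  rw [h1, Finset.prod_one_add]
  refine Finset.sum_congr rfl fun F hF => ?_
  rw [integral_indicator_const _ (hm F), h F (Finset.mem_powerset.1 hF), smul_eq_mul,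
    Finset.prod_const, mul_pow, mul_comm]

open Classical in
-- Markov's inequality for `2^N`, `N` being the number of successes.
lemma measureReal_lt_card_filter_le (hA : ∀ e, MeasurableSet (A e))
    (h : ∀ F ⊆ Finset.range E, μ.real (⋂ e ∈ F, A e) = q ^ F.card) (a : ℝ) :
    μ.real {ω | a < ((Finset.range E).filter fun e => ω ∈ A e).card}
      ≤ (1 + q) ^ E * Real.exp (-(a * Real.log 2)) := by
  obtain ⟨h1, h2⟩ := integral_pow_card_filter hA h 2
  have h3 := mul_meas_ge_le_integral_of_nonneg
    (Filter.Eventually.of_forall fun ω => by positivity) h1 (Real.exp (a * Real.log 2))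
  rw [h2] at h3
  have h4 : μ.real {ω | a < ((Finset.range E).filter fun e => ω ∈ A e).card}
      ≤ μ.real {ω | Real.exp (a * Real.log 2)
        ≤ 2 ^ ((Finset.range E).filter fun e => ω ∈ A e).card} := by
    refine measureReal_mono fun ω hω => ?_
    simp only [Set.mem_ofPred_eq] at hω ⊢
    rw [← Real.rpow_natCast, Real.rpow_def_of_pos two_pos, mul_comm]
    exact Real.exp_le_exp.2 (mul_le_mul_of_nonneg_left hω.le (Real.log_nonneg one_le_two))
  rw [Real.exp_neg, ← div_eq_mul_inv, le_div_iff₀ (Real.exp_pos _), mul_comm]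
  refine (mul_le_mul_of_nonneg_left h4 (Real.exp_pos _).le).trans (h3.trans (le_of_eq ?_))
  ring

open Classical in
-- Markov's inequality for `2^(-N)`.
lemma measureReal_card_filter_le_le (hA : ∀ e, MeasurableSet (A e))
    (h : ∀ F ⊆ Finset.range E, μ.real (⋂ e ∈ F, A e) = q ^ F.card) (a : ℝ) :
    μ.real {ω | (((Finset.range E).filter fun e => ω ∈ A e).card : ℝ) ≤ a}
      ≤ (1 - q / 2) ^ E * Real.exp (a * Real.log 2) := by
  obtain ⟨h1, h2⟩ := integral_pow_card_filter hA h (1 / 2)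
  have h3 := mul_meas_ge_le_integral_of_nonneg
    (Filter.Eventually.of_forall fun ω => by positivity) h1 (Real.exp (-(a * Real.log 2)))
  rw [h2] at h3
  have h4 : μ.real {ω | (((Finset.range E).filter fun e => ω ∈ A e).card : ℝ) ≤ a}
      ≤ μ.real {ω | Real.exp (-(a * Real.log 2))
        ≤ (1 / 2) ^ ((Finset.range E).filter fun e => ω ∈ A e).card} := by
    refine measureReal_mono fun ω hω => ?_
    simp only [Set.mem_ofPred_eq] at hω ⊢
    rw [← Real.rpow_natCast, Real.rpow_def_of_pos (by norm_num), one_div, Real.log_inv]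
    refine Real.exp_le_exp.2 ?_
    have := mul_le_mul_of_nonneg_left hω (Real.log_nonneg one_le_two)
    linarith
  rw [← div_le_iff₀ (Real.exp_pos _), div_eq_mul_inv, ← Real.exp_neg, mul_comm]
  refine (mul_le_mul_of_nonneg_left h4 (Real.exp_pos _).le).trans (h3.trans (le_of_eq ?_))
  ring

end Moment

/-! ### Probabilities of cylinders -/

section Cylinders

variable {P : Params} {V : Type*}

instance (P : Params) (V : Type*) : IsProbabilityMeasure (coinLaw P V) := by
  unfold coinLaw; infer_instance

lemma colourLaw_singleton_false (i : ℕ) :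
    (colourLaw P i) {false} = ENNReal.ofReal (1 - P.p (est i)) := by
  rw [colourLaw, bernoulliMeasure_apply _ (MeasurableSet.singleton false)]
  simp only [Set.mem_singleton_iff, Bool.true_eq_false, if_true, if_false]
  rw [ENNReal.ofReal, ENNReal.coe_inj]
  ext
  rw [Real.coe_toNNReal _ (by linarith [(p_mem P i).2])]
  simp

lemma drawLaw_singleton {i d : ℕ} (hd : d ∈ Finset.Icc 1 (P.idMax (est i))) :
    drawLaw P i {d} = (P.idMax (est i) : ENNReal)⁻¹ := by
  rw [drawLaw, PMF.toMeasure_apply_singleton _ _ (MeasurableSet.singleton d),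
    PMF.uniformOfFinset_apply_of_mem _ hd, Nat.card_Icc, Nat.add_sub_cancel]

lemma drawLaw_compl_Icc (i : ℕ) :
    drawLaw P i (Finset.Icc 1 (P.idMax (est i)) : Set ℕ)ᶜ = 0 := by
  rw [drawLaw, PMF.toMeasure_apply_eq_zero_iff _ (Finset.measurableSet _).compl,
    PMF.support_uniformOfFinset]
  exact disjoint_compl_right

lemma coinLaw_colours (F : Finset (ℕ × ℕ × V)) :
    (coinLaw P V).real {ω | ∀ x ∈ F, ω.1 x = false} = ∏ x ∈ F, (1 - P.p (est x.1)) := by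
  have h : {ω : Coins V | ∀ x ∈ F, ω.1 x = false}
      = (Set.pi (F : Set (ℕ × ℕ × V)) fun _ => ({false} : Set Bool)) ×ˢ Set.univ := by
    ext ω; simp
  rw [h, measureReal_def, coinLaw, Measure.prod_prod, measure_univ, mul_one,
    Measure.infinitePi_pi _ fun _ _ => MeasurableSet.singleton false, ENNReal.toReal_prod]
  refine Finset.prod_congr rfl fun x _ => ?_
  rw [colourLaw_singleton_false, ENNReal.toReal_ofReal (by linarith [(p_mem P x.1).2])]

lemma coinLaw_draws (F : Finset (ℕ × V)) (t : ℕ × V → Set ℕ) :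
    coinLaw P V {ω | ∀ x ∈ F, ω.2 x ∈ t x} = ∏ x ∈ F, drawLaw P x.1 (t x) := by
  have h : {ω : Coins V | ∀ x ∈ F, ω.2 x ∈ t x}
      = Set.univ ×ˢ (Set.pi (F : Set (ℕ × V)) t) := by
    ext ω; simp
  rw [h, coinLaw, Measure.prod_prod, measure_univ, one_mul,
    Measure.infinitePi_pi _ fun _ _ => MeasurableSet.of_discrete]

lemma ae_draw_mem_Icc (P : Params) (V : Type*) (i : ℕ) (v : V) :
    ∀ᵐ ω ∂coinLaw P V, ω.2 (i, v) ∈ Finset.Icc 1 (P.idMax (est i)) := by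
  have h := coinLaw_draws (P := P) {(i, v)} fun x => (Finset.Icc 1 (P.idMax (est x.1)) : Set ℕ)ᶜ
  simp only [Finset.mem_singleton, forall_eq, Finset.prod_singleton, drawLaw_compl_Icc] at h
  rw [ae_iff, ← h]
  rfl

/-- Almost surely the common value lies in `{1, …, M}`; each of these `M` values is hit by both
nodes with probability `1/M²`. -/
lemma coinLaw_draw_eq_le (i : ℕ) {u v : V} (huv : u ≠ v) :
    (coinLaw P V).real {ω | ω.2 (i, u) = ω.2 (i, v)} ≤ 1 / P.idMax (est i) := by
  classical
  set M := P.idMax (est i) with hM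
  have hM0 : (M : ENNReal) ≠ 0 := by
    have := one_le_idMax P i
    rw [Ne, Nat.cast_eq_zero]; omega
  have hpair : ∀ d ∈ Finset.Icc 1 M,
      coinLaw P V {ω | ω.2 (i, u) = d ∧ ω.2 (i, v) = d} = (M : ENNReal)⁻¹ * (M : ENNReal)⁻¹ := by
    intro d hd
    have h := coinLaw_draws (P := P) {(i, u), (i, v)} fun _ => {d}
    rw [Finset.prod_pair (by simpa using huv)] at h
    simp only [Finset.mem_insert, Finset.mem_singleton, forall_eq_or_imp, forall_eq,
      Set.mem_singleton_iff, drawLaw_singleton hd] at h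
    exact h
  have hsub : coinLaw P V {ω | ω.2 (i, u) = ω.2 (i, v)}
      ≤ coinLaw P V (⋃ d ∈ Finset.Icc 1 M, {ω | ω.2 (i, u) = d ∧ ω.2 (i, v) = d}) := by
    refine measure_mono_ae ?_
    filter_upwards [ae_draw_mem_Icc P V i u] with ω hω h
    exact Set.mem_biUnion (show ω.2 (i, u) ∈ (Finset.Icc 1 M : Finset ℕ) from hω)
      ⟨rfl, Eq.symm h⟩
  have hsum : coinLaw P V {ω | ω.2 (i, u) = ω.2 (i, v)} ≤ (M : ENNReal)⁻¹ := by
    refine hsub.trans ((measure_biUnion_finset_le _ _).trans (le_of_eq ?_))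
    rw [Finset.sum_congr rfl hpair, Finset.sum_const, Nat.card_Icc, Nat.add_sub_cancel,
      nsmul_eq_mul, ← mul_assoc, ENNReal.mul_inv_cancel hM0 (ENNReal.natCast_ne_top M), one_mul]
  rw [measureReal_def, one_div, ← ENNReal.toReal_natCast, ← ENNReal.toReal_inv]
  exact ENNReal.toReal_mono (ENNReal.inv_ne_top.2 hM0) hsum

lemma coinLaw_quiet (i : ℕ) (S : Finset V) (F : Finset ℕ) :
    (coinLaw P V).real (⋂ e ∈ F, {ω | Quiet ω i S e})
      = ((1 - P.p (est i)) ^ S.card) ^ F.card := by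
  have h : (⋂ e ∈ F, {ω : Coins V | Quiet ω i S e})
      = {ω | ∀ x ∈ ({i} : Finset ℕ) ×ˢ F ×ˢ S, ω.1 x = false} := by
    ext ω
    simp only [Quiet, Set.mem_iInter, Set.mem_ofPred_eq, Finset.mem_product, Finset.mem_singleton,
      Prod.forall]
    constructor
    · rintro h _ e v ⟨rfl, he, hv⟩
      exact h e he v hv
    · exact fun h e he v hv => h i e v ⟨rfl, he, hv⟩
  rw [h, coinLaw_colours, Finset.prod_product]
  simp only [Finset.prod_singleton, Finset.prod_const, Finset.card_product]
  rw [← pow_mul, mul_comm]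

lemma measurableSet_quiet (i : ℕ) (S : Finset V) (e : ℕ) :
    MeasurableSet {ω : Coins V | Quiet ω i S e} := by
  have : {ω : Coins V | Quiet ω i S e} = ⋂ u ∈ S, {ω | ω.1 (i, e, u) = false} := by
    ext; simp [Quiet]
  rw [this]
  refine S.measurableSet_biInter fun u _ => ?_
  have h : Measurable fun ω : Coins V => ω.1 (i, e, u) := by fun_prop
  exact h (MeasurableSet.singleton false)

lemma coinLaw_lt_quietCount_le (i : ℕ) (S : Finset V) (a : ℝ) :
    (coinLaw P V).real {ω | a < quietCount ω i P S}
      ≤ (1 + (1 - P.p (est i)) ^ S.card) ^ P.execs (est i) * Real.exp (-(a * Real.log 2)) :=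
  measureReal_lt_card_filter_le (measurableSet_quiet i S) (fun F _ => coinLaw_quiet i S F) a

lemma coinLaw_quietCount_le_le (i : ℕ) (S : Finset V) (a : ℝ) :
    (coinLaw P V).real {ω | (quietCount ω i P S : ℝ) ≤ a}
      ≤ (1 - (1 - P.p (est i)) ^ S.card / 2) ^ P.execs (est i) * Real.exp (a * Real.log 2) :=
  measureReal_card_filter_le_le (measurableSet_quiet i S) (fun F _ => coinLaw_quiet i S F) a

end Cylinders

/-! ### Estimates of the parameters -/

section Parameters

variable (P : Params) (i : ℕ)

lemma est_le_pw : (est i : ℝ) ≤ P.pw (est i) := by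
  refine (Real.rpow_one _).symm.le.trans ?_
  exact Real.rpow_le_rpow_of_exponent_le (est_pos i) (by linarith [P.ε_pos])

lemma two_pow_le_pw : (2 : ℝ) ^ (i + 1) ≤ P.pw (est i) := by
  have := est_le_pw P i
  simpa [est] using this

lemma two_le_pw : 2 ≤ P.pw (est i) := by
  refine le_trans ?_ (two_pow_le_pw P i)
  rw [pow_succ]
  linarith [one_le_pow₀ (M₀ := ℝ) one_le_two (n := i)]

lemma pw_le_sq : P.pw (est i) ≤ (est i : ℝ) ^ 2 := by
  rw [← Real.rpow_two]
  exact Real.rpow_le_rpow_of_exponent_le (est_pos i) (by linarith [P.ε_le_one])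

lemma pw_est_succ : 2 * P.pw (est i) ≤ P.pw (est (i + 1)) ∧
    P.pw (est (i + 1)) ≤ 4 * P.pw (est i) := by
  have h : P.pw (est (i + 1)) = 2 ^ (1 + P.ε) * P.pw (est i) := by
    have : ((est (i + 1) : ℕ) : ℝ) = 2 * (est i : ℝ) := by
      rw [est, est, pow_succ]; push_cast; ring
    rw [Params.pw, this, Real.mul_rpow two_pos.le (Nat.cast_nonneg _), Params.pw]
  have h1 : (2 : ℝ) ≤ 2 ^ (1 + P.ε) := by
    refine (Real.rpow_one _).symm.le.trans ?_
    exact Real.rpow_le_rpow_of_exponent_le one_le_two (by linarith [P.ε_pos])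
  have h2 : (2 : ℝ) ^ (1 + P.ε) ≤ 4 := by
    refine (Real.rpow_le_rpow_of_exponent_le (z := 2) one_le_two
      (by linarith [P.ε_le_one])).trans ?_
    norm_num
  have h3 := two_le_pw P i
  rw [h]
  constructor <;> gcongr

lemma pw_est_mono : Monotone fun i => P.pw (est i) :=
  monotone_nat_of_le_succ fun i => by linarith [(pw_est_succ P i).1, two_le_pw P i]

lemma log_pw_div_pos : 0 < Real.log (P.pw (est i) / P.ξ) := by
  apply Real.log_pos
  rw [one_lt_div P.ξ_pos]
  linarith [two_le_pw P i, P.ξ_lt_one]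

lemma f_bounds : 32 * Real.log (P.pw (est i) / P.ξ) ≤ P.f (est i) ∧
    P.f (est i) ≤ 34 * Real.log (P.pw (est i) / P.ξ) := by
  have h0 := (log_pw_div_pos P i).le
  have h1 : √2 ^ 2 = 2 := Real.sq_sqrt two_pos.le
  have h2 : 1.4142 ≤ √2 := Real.le_sqrt_of_sq_le (by norm_num)
  have h3 : √2 ≤ 1.4143 := by
    rw [Real.sqrt_le_left (by norm_num)]; norm_num
  have h4 : 0 < (√2 - 1) ^ 2 := by apply pow_pos; linarith
  rw [Params.f, le_div_iff₀ h4, div_le_iff₀ h4]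
  -- The constant in `f` is `4√2/(3 - 2√2)`, about `32.97`.
  have h5 : (√2 - 1) ^ 2 = 3 - 2 * √2 := by linear_combination h1
  rw [h5]
  constructor
  · have : 32 * (3 - 2 * √2) ≤ 4 * √2 := by linarith
    nlinarith
  · have : 4 * √2 ≤ 34 * (3 - 2 * √2) := by linarith
    nlinarith

lemma exp_neg_log_pw_div :
    Real.exp (-Real.log (P.pw (est i) / P.ξ)) = P.ξ / P.pw (est i) := by
  have := two_le_pw P i
  rw [Real.exp_neg, Real.exp_log (div_pos (by linarith) P.ξ_pos), inv_div]

lemma f_nonneg : 0 ≤ P.f (est i) := by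
  linarith [(f_bounds P i).1, log_pw_div_pos P i]

lemma execs_le : (P.execs (est i) : ℝ) ≤ P.f (est i) := Nat.floor_le (f_nonneg P i)

lemma f_le_execs_add_one : P.f (est i) ≤ P.execs (est i) + 1 := (Nat.lt_floor_add_one _).le

lemma execs_pos : 0 < P.execs (est i) := by
  refine Nat.floor_pos.2 ?_
  have h1 : Real.log 2 ≤ Real.log (P.pw (est i) / P.ξ) := by
    refine Real.log_le_log two_pos ?_
    rw [le_div_iff₀ P.ξ_pos]
    nlinarith [two_le_pw P i, P.ξ_lt_one]
  linarith [(f_bounds P i).1, Real.log_two_gt_d9]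

/-- The left side is at most `(8/9)^(f/2)`. With `log(9/8) ≥ 1/9` and `f ≥ 32 log(K/ξ)` the exponent
exceeds what is required. -/
lemma pow_mul_exp_le_of_le_third {q : ℝ} (hq0 : 0 ≤ q) (hq : q ≤ 1 / 3) :
    (1 + q) ^ P.execs (est i) * Real.exp (-(P.f (est i) / 2 * Real.log 2))
      ≤ P.ξ / P.pw (est i) := by
  have h1 : (1 + q) ^ P.execs (est i) ≤ Real.exp (P.f (est i) * Real.log (4 / 3)) := by
    calc (1 + q) ^ P.execs (est i) ≤ (4 / 3) ^ P.execs (est i) := by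
          gcongr; linarith
      _ = Real.exp (P.execs (est i) * Real.log (4 / 3)) := by
          rw [Real.exp_nat_mul, Real.exp_log (by norm_num)]
      _ ≤ _ := Real.exp_le_exp.2
          (mul_le_mul_of_nonneg_right (execs_le P i) (Real.log_nonneg (by norm_num)))
  have h2 : Real.log (9 / 8) = Real.log 2 - 2 * Real.log (4 / 3) := by
    rw [show (9 / 8 : ℝ) = 2 / (4 / 3) ^ 2 by norm_num,
      Real.log_div (by norm_num) (by norm_num), Real.log_pow]
    norm_num
  have h3 := Real.one_sub_inv_le_log_of_pos (show (0 : ℝ) < 9 / 8 by norm_num)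
  norm_num at h3
  refine (mul_le_mul_of_nonneg_right h1 (Real.exp_pos _).le).trans ?_
  rw [← Real.exp_add, ← exp_neg_log_pw_div]
  refine Real.exp_le_exp.2 ?_
  have h4 := (f_bounds P i).1
  have h5 := log_pw_div_pos P i
  have h6 : P.f (est i) * (1 / 9) ≤ P.f (est i) * (Real.log 2 - 2 * Real.log (4 / 3)) :=
    mul_le_mul_of_nonneg_left (by linarith) (f_nonneg P i)
  linarith

/-- Here `1 - q/2 ≤ 27/40`, so the base is `(27/40)² · 2 = 729/800`, to the power `f/2`. Rounding
`f` down costs one factor `40/27 ≤ 3/2`. -/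
lemma pow_mul_exp_le_of_ge {q : ℝ} (hq : 13 / 20 ≤ q) (hq1 : q ≤ 1) :
    (1 - q / 2) ^ P.execs (est i) * Real.exp (P.f (est i) / 2 * Real.log 2)
      ≤ 3 / 2 * (P.ξ / P.pw (est i)) := by
  have h0 : 0 ≤ Real.log (40 / 27) := Real.log_nonneg (by norm_num)
  have h1 : (1 - q / 2) ^ P.execs (est i)
      ≤ 3 / 2 * Real.exp (-(P.f (est i) * Real.log (40 / 27))) := by
    calc (1 - q / 2) ^ P.execs (est i) ≤ (27 / 40) ^ P.execs (est i) := by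
          apply pow_le_pow_left₀ <;> linarith
      _ = Real.exp (P.execs (est i) * -Real.log (40 / 27)) := by
          rw [Real.exp_nat_mul, ← Real.log_inv, Real.exp_log (by norm_num)]
          norm_num
      _ ≤ Real.exp (Real.log (40 / 27) + -(P.f (est i) * Real.log (40 / 27))) := by
          refine Real.exp_le_exp.2 ?_
          nlinarith [f_le_execs_add_one P i]
      _ ≤ _ := by
          rw [Real.exp_add, Real.exp_log (by norm_num)]
          exact mul_le_mul_of_nonneg_right (by norm_num) (Real.exp_pos _).le
  have h2 : Real.log (800 / 729) = 2 * Real.log (40 / 27) - Real.log 2 := by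
    rw [show (800 / 729 : ℝ) = (40 / 27) ^ 2 / 2 by norm_num,
      Real.log_div (by norm_num) (by norm_num), Real.log_pow]
    norm_num
  have h3 := Real.one_sub_inv_le_log_of_pos (show (0 : ℝ) < 800 / 729 by norm_num)
  norm_num at h3
  refine (mul_le_mul_of_nonneg_right h1 (Real.exp_pos _).le).trans ?_
  rw [mul_assoc, ← Real.exp_add, ← exp_neg_log_pw_div]
  refine mul_le_mul_of_nonneg_left (Real.exp_le_exp.2 ?_) (by norm_num)
  have h4 := (f_bounds P i).1
  have h5 := log_pw_div_pos P i
  have h6 : P.f (est i) * (71 / 800)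
      ≤ P.f (est i) * (2 * Real.log (40 / 27) - Real.log 2) :=
    mul_le_mul_of_nonneg_left (by linarith) (f_nonneg P i)
  linarith

lemma one_sub_p_nonneg : 0 ≤ 1 - P.p (est i) := by linarith [(p_mem P i).2]

lemma one_sub_p_pow_le (m : ℕ) :
    (1 - P.p (est i)) ^ m ≤ Real.exp (-(m * P.p (est i))) := by
  have h : 1 - P.p (est i) ≤ Real.exp (-P.p (est i)) := by
    linarith [Real.add_one_le_exp (-P.p (est i))]
  refine (pow_le_pow_left₀ (one_sub_p_nonneg P i) h m).trans (le_of_eq ?_)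
  rw [← Real.exp_nat_mul]
  ring_nf

/-- If the set `S` is large compared with the estimate, it often contains a white node. -/
lemma one_sub_p_pow_le_third {m : ℕ} (hm : 5 / 3 * P.pw (est i) ≤ m) :
    (1 - P.p (est i)) ^ m ≤ 1 / 3 := by
  have h0 := two_le_pw P i
  refine (one_sub_p_pow_le P i m).trans ?_
  rw [one_div, ← Real.exp_log (show (0 : ℝ) < 3⁻¹ by norm_num), Real.log_inv]
  refine Real.exp_le_exp.2 (neg_le_neg ?_)
  -- `3³ ≤ 2⁵` gives `log 3 ≤ (5/3) log 2`, the origin of the constant `5/3`.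
  have h1 : Real.log (27 : ℝ) ≤ Real.log 32 := Real.log_le_log (by norm_num) (by norm_num)
  rw [show (27 : ℝ) = 3 ^ 3 by norm_num, show (32 : ℝ) = 2 ^ 5 by norm_num, Real.log_pow,
    Real.log_pow] at h1
  push_cast at h1
  have h2 : 5 / 3 * Real.log 2 ≤ m * P.p (est i) := by
    rw [Params.p, mul_div_assoc', le_div_iff₀ (by linarith)]
    nlinarith [Real.log_two_gt_d9]
  linarith

/-- Bernoulli's inequality with `n p ≤ (ln 2)/2 < 7/20`. -/
lemma one_sub_p_pow_ge {n : ℕ} (hn : 2 * (n : ℝ) ≤ P.pw (est i)) :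
    13 / 20 ≤ (1 - P.p (est i)) ^ n := by
  have h0 := two_le_pw P i
  have h1 := one_add_mul_le_pow (a := -P.p (est i)) (by linarith [(p_mem P i).2]) n
  rw [← sub_eq_add_neg] at h1
  refine le_trans ?_ h1
  have h2 : n * P.p (est i) ≤ 7 / 20 := by
    rw [Params.p, mul_div_assoc', div_le_iff₀ (by linarith)]
    nlinarith [Real.log_two_lt_d9, Real.log_two_gt_d9, Nat.cast_nonneg (α := ℝ) n]
  linarith

/-- The upper bound on `K` keeps `n p ≥ (ln 2)/8 > 1/12`, so white nodes are not too rare. The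
factor `2` pays for rounding `f` down, as `n p ≤ ln 2`. -/
lemma one_sub_p_pow_pow_execs_le {n : ℕ} (hn : 2 * (n : ℝ) ≤ P.pw (est i))
    (hn' : P.pw (est i) ≤ 8 * n) :
    ((1 - P.p (est i)) ^ n) ^ P.execs (est i) ≤ 2 * (P.ξ / P.pw (est i)) := by
  have h0 := two_le_pw P i
  rw [← pow_mul]
  refine (one_sub_p_pow_le P i _).trans ?_
  rw [← exp_neg_log_pw_div, ← Real.exp_log two_pos, ← Real.exp_add]
  refine Real.exp_le_exp.2 ?_
  push_cast
  set x := (n : ℝ) * P.p (est i) with hx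
  have h2 : x ≤ Real.log 2 := by
    rw [hx, Params.p, mul_div_assoc', div_le_iff₀ (by linarith)]
    nlinarith [Real.log_two_gt_d9, Nat.cast_nonneg (α := ℝ) n]
  have h3 : 1 / 12 ≤ x := by
    rw [hx, Params.p, mul_div_assoc', le_div_iff₀ (by linarith)]
    nlinarith [Real.log_two_gt_d9, Nat.cast_nonneg (α := ℝ) n]
  have h4 : P.f (est i) * (1 / 12) ≤ P.f (est i) * x :=
    mul_le_mul_of_nonneg_left h3 (f_nonneg P i)
  have h5 : P.f (est i) * x ≤ (P.execs (est i) + 1) * x :=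
    mul_le_mul_of_nonneg_right (f_le_execs_add_one P i) (by linarith)
  have h6 := (f_bounds P i).1
  have h7 := log_pw_div_pos P i
  have h8 : (n : ℝ) * P.execs (est i) * P.p (est i) = P.execs (est i) * x := by rw [hx]; ring
  rw [h8]
  linarith

lemma mixing_of_le {n : ℕ} (hn : 1 < n) (h : 2 * (n : ℝ) ≤ P.pw (est i)) :
    Mixing P n (est i) := by
  refine ⟨h, ?_⟩
  have hn' : (2 : ℝ) ≤ n := by exact_mod_cast hn
  set K := P.pw (est i) with hK
  have hK0 : 0 < K := by linarith
  have hk := est_pos i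
  have hlogK : Real.log (2 * n) ≤ Real.logb 2 K := by
    refine (Real.log_le_log (by linarith) h).trans ?_
    rw [Real.logb, le_div_iff₀ (Real.log_pos one_lt_two)]
    have : 0 ≤ Real.log K := Real.log_nonneg (by linarith)
    nlinarith [Real.log_two_lt_d9]
  -- `k^(2(2+ε)) = K² k²`, and `k² ≥ K` because `ε ≤ 1`. The second summand of `r(k)` is at least
  -- `1` and absorbs the floor.
  have h1 : 4 * K ^ 3 * Real.logb 2 K ≤ P.diffRounds (est i) := by
    have e1 : (est i : ℝ) ^ (2 * (2 + P.ε)) = K ^ 2 * (est i : ℝ) ^ 2 := by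
      rw [hK, Params.pw, ← Real.rpow_mul_natCast (by linarith), ← Real.rpow_natCast (est i : ℝ) 2,
        ← Real.rpow_add (by linarith)]
      push_cast
      ring_nf
    have e2 : Real.logb 2 ((est i : ℝ) ^ (2 * (1 + P.ε))) = 2 * Real.logb 2 K := by
      rw [hK, Params.pw, Real.logb_rpow_eq_mul_logb_of_pos (by linarith),
        Real.logb_rpow_eq_mul_logb_of_pos (by linarith)]
      ring
    have e3 : 1 ≤ Real.logb 2 (2 * (est i : ℝ)) := by
      rw [Real.le_logb_iff_rpow_le one_lt_two (by linarith), Real.rpow_one]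
      linarith
    have hr : 4 * K ^ 3 * Real.logb 2 K + 1 ≤ P.r (est i) := by
      have h2 := pw_le_sq P i
      have h3 : 0 ≤ Real.logb 2 K := Real.logb_nonneg one_lt_two (by linarith)
      have h4 : K ^ 3 * Real.logb 2 K ≤ K ^ 2 * (est i : ℝ) ^ 2 * Real.logb 2 K := by
        rw [pow_succ]
        gcongr
      have h5 : (1 : ℝ) ≤ K * Real.logb 2 (2 * (est i : ℝ)) :=
        one_le_mul_of_one_le_of_one_le (by linarith) e3
      rw [Params.r, e1, e2]
      change _ ≤ _ + K * _
      linarith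
    have h6 := (Nat.lt_floor_add_one (P.r (est i))).le
    change _ ≤ ((⌊P.r (est i)⌋₊ : ℕ) : ℝ)
    linarith
  have h2 : Real.log (9 * (n : ℝ) ^ 3) ≤ 6 * Real.log (2 * n) := by
    have : 6 * Real.log (2 * n) = Real.log ((2 * n : ℝ) ^ 6) := by
      rw [Real.log_pow]; norm_num
    rw [this]
    refine Real.log_le_log (by positivity) ?_
    have h3 : (1 : ℝ) ≤ (n : ℝ) ^ 3 := one_le_pow₀ (by linarith)
    calc 9 * (n : ℝ) ^ 3 ≤ 64 * ((n : ℝ) ^ 3 * (n : ℝ) ^ 3) := by nlinarith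
      _ = _ := by ring
  have h0 : 0 ≤ Real.log (2 * n) := Real.log_nonneg (by linarith)
  calc Real.log (9 * (n : ℝ) ^ 3) ≤ 6 * Real.log (2 * n) := h2
    _ ≤ 3 / 2 * (K / n) ^ 2 * Real.log (2 * n) := by
      have h3 : 2 ≤ K / n := by rw [le_div_iff₀ (by linarith)]; linarith
      gcongr
      nlinarith
    _ ≤ 3 / 2 * (K / n) ^ 2 * Real.logb 2 K := by gcongr
    _ = 3 / (4 * (2 * K) * (n : ℝ) ^ 2) * (4 * K ^ 3 * Real.logb 2 K) := by
      field_simp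
    _ ≤ _ := by gcongr

lemma le_dissRounds {n : ℕ} (h : 2 * (n : ℝ) ≤ P.pw (est i)) : n ≤ P.dissRounds (est i) :=
  Nat.le_floor (by linarith [Nat.cast_nonneg (α := ℝ) n])

/-- As `k ≥ 2`, the range is at least `(n/2)⁴ · 3⁴ = (81/16) n⁴` before rounding; the excess over
`5n⁴` is at least `1`. -/
lemma idMax_ge {n : ℕ} (hn : 1 < n) (h : (n : ℝ) / 2 < P.pw (est i)) :
    5 * (n : ℝ) ^ 4 ≤ P.idMax (est i) := by
  have hn' : (2 : ℝ) ≤ n := by exact_mod_cast hn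
  have hk := est_pos i
  have hk2 : (2 : ℝ) ≤ est i := by
    rw [est, pow_succ]; push_cast
    linarith [one_le_pow₀ (M₀ := ℝ) one_le_two (n := i)]
  have h1 : (est i : ℝ) ^ (4 * (1 + P.ε)) = P.pw (est i) ^ 4 := by
    rw [Params.pw, ← Real.rpow_mul_natCast (by linarith)]
    push_cast
    ring_nf
  have h2 : 3 ≤ Real.logb 2 (4 * (est i : ℝ)) := by
    rw [Real.le_logb_iff_rpow_le one_lt_two (by linarith)]
    norm_num
    linarith
  have h3 : ((n : ℝ) / 2) ^ 4 * 3 ^ 4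
      ≤ (est i : ℝ) ^ (4 * (1 + P.ε)) * Real.logb 2 (4 * (est i : ℝ)) ^ 4 := by
    rw [h1]
    gcongr
  have h4 := (Nat.lt_floor_add_one
    ((est i : ℝ) ^ (4 * (1 + P.ε)) * Real.logb 2 (4 * (est i : ℝ)) ^ 4)).le
  have h5 : (2 : ℝ) ^ 4 ≤ (n : ℝ) ^ 4 := by gcongr
  change _ ≤ ((⌊_⌋₊ : ℕ) : ℝ)
  linarith

/-- The bound `log(4k) ≤ 4k` suffices: `k⁸ (4k)⁴` is a power of two with exponent linear in `i`. -/
lemma idMax_lt : P.idMax (est i) < 2 ^ (12 * (i + 1) + 9) := by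
  have hk := est_pos i
  have h1 : (est i : ℝ) ^ (4 * (1 + P.ε)) ≤ (est i : ℝ) ^ (8 : ℕ) := by
    rw [← Real.rpow_natCast]
    exact Real.rpow_le_rpow_of_exponent_le hk (by push_cast; linarith [P.ε_le_one])
  have h2 : Real.logb 2 (4 * (est i : ℝ)) ≤ 4 * (est i : ℝ) := by
    have e : (4 * (est i : ℝ)) = 2 ^ (i + 3) := by
      rw [est]; push_cast; ring
    rw [e, Real.logb_pow, Real.logb_self_eq_one one_lt_two, mul_one]
    exact_mod_cast Nat.lt_two_pow_self.le
  have h3 : 0 ≤ Real.logb 2 (4 * (est i : ℝ)) := Real.logb_nonneg one_lt_two (by linarith)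
  have h4 : (P.idMax (est i) : ℝ) ≤ 2 ^ (12 * (i + 1) + 8) := by
    refine (Nat.floor_le (by positivity)).trans ?_
    calc _ ≤ (est i : ℝ) ^ (8 : ℕ) * (4 * (est i : ℝ)) ^ 4 := by gcongr
      _ = _ := by rw [est]; push_cast; ring
  have h5 : P.idMax (est i) ≤ 2 ^ (12 * (i + 1) + 8) := by exact_mod_cast h4
  exact h5.trans_lt (Nat.pow_lt_pow_right one_lt_two (by omega))

end Parameters

/-! ### The running time -/

lemma execTime_le (P : Params) {i : ℕ} {L : ℝ} (hL : 1 ≤ L)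
    (h : Real.logb 2 (2 * P.pw (est i)) ≤ 9 * L) :
    (execTime P (est i) (P.numRounds (est i)) : ℝ)
      ≤ 10 * (P.diffRounds (est i) : ℝ) ^ 2 * L + P.dissRounds (est i) := by
  set D := P.diffRounds (est i) with hD
  have h0 : 0 ≤ Real.logb 2 (2 * P.pw (est i)) :=
    Real.logb_nonneg one_lt_two (by linarith [two_le_pw P i])
  have h1 : ∀ j ∈ Finset.range D, (cost P (est i) j : ℝ) ≤ 10 * D * L := by
    intro j hj
    have hj' : j < P.diffRounds (est i) := Finset.mem_range.1 hj
    have hjD : (j : ℝ) + 1 ≤ D := by exact_mod_cast hj'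
    have hD1 : (1 : ℝ) ≤ D := by linarith [Nat.cast_nonneg (α := ℝ) j]
    rw [cost, if_pos hj']
    refine (Nat.ceil_lt_add_one (by positivity)).le.trans ?_
    have h2 : ((j : ℝ) + 1) * Real.logb 2 (2 * P.pw (est i)) ≤ D * (9 * L) := by gcongr
    have h3 : 1 ≤ D * L := one_le_mul_of_one_le_of_one_le hD1 hL
    linarith
  have h2 : ∀ j ∈ Finset.range (P.dissRounds (est i)), (cost P (est i) (D + j) : ℝ) = 1 := by
    intro j _
    rw [cost, if_neg (by omega), Nat.cast_one]
  rw [execTime, Params.numRounds, Finset.sum_range_add]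
  push_cast
  rw [Finset.sum_congr rfl h2]
  refine add_le_add ((Finset.sum_le_sum h1).trans (le_of_eq ?_)) (by simp)
  rw [Finset.sum_const, Finset.card_range, nsmul_eq_mul]
  ring

lemma one_le_logb_two {n : ℕ} (hn : 1 < n) : 1 ≤ Real.logb 2 n := by
  rw [Real.le_logb_iff_rpow_le one_lt_two (by positivity), Real.rpow_one]
  exact_mod_cast hn

lemma logb_two_eight_mul_le {n : ℕ} (hn : 1 < n) :
    Real.logb 2 (8 * n) ≤ 4 * Real.logb 2 n := by
  have h1 := one_le_logb_two hn
  rw [Real.logb_mul (by norm_num) (by positivity), show (8 : ℝ) = 2 ^ 3 by norm_num,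
    Real.logb_pow, Real.logb_self_eq_one one_lt_two]
  push_cast
  linarith

lemma exists_iteration_time_le (P : Params) : ∃ C : ℝ, 0 < C ∧ ∀ n : ℕ, 1 < n → ∀ i : ℕ,
    (est i : ℝ) ≤ 8 * n →
      ((P.execs (est i) * execTime P (est i) (P.numRounds (est i)) : ℕ) : ℝ)
        ≤ C * (n : ℝ) ^ (4 * (2 + P.ε)) * Real.logb 2 n ^ 4 := by
  set b := Real.log (1 / P.ξ) with hb
  have hb0 : 0 ≤ b := Real.log_nonneg (by
    rw [le_div_iff₀ P.ξ_pos]; linarith [P.ξ_lt_one])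
  -- `a` bounds the two summands of `r(k)` for `k ≤ 8n`: `2 · 8⁶ · 16` from the first, as `2(2+ε) ≤
  -- 6`, and `64 · 5` from the second.
  set a : ℝ := 32 * 8 ^ 6 + 320 with ha
  refine ⟨34 * (8 + b) * (10 * a ^ 2 + 64), by positivity, fun n hn i hi => ?_⟩
  have hn' : (2 : ℝ) ≤ n := by exact_mod_cast hn
  set L := Real.logb 2 n with hLdef
  have hL : 1 ≤ L := one_le_logb_two hn
  set k : ℝ := (est i : ℝ) with hk
  have hk1 : 1 ≤ k := est_pos i
  have hε := P.ε_pos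
  have hε1 := P.ε_le_one
  set x : ℝ := (n : ℝ) ^ (2 * (2 + P.ε)) with hx
  have hx2 : (n : ℝ) ^ (4 * (2 + P.ε)) = x ^ 2 := by
    rw [hx, ← Real.rpow_mul_natCast (by linarith)]
    push_cast
    ring_nf
  have hnx : (n : ℝ) ^ 2 ≤ x := by
    rw [hx, ← Real.rpow_natCast]
    exact Real.rpow_le_rpow_of_exponent_le (by linarith) (by push_cast; linarith)
  have hx1 : 1 ≤ x := le_trans (one_le_pow₀ (by linarith)) hnx
  have hlogk : Real.logb 2 k ≤ 4 * L :=
    (Real.logb_le_logb_of_le one_lt_two (by linarith) hi).trans (logb_two_eight_mul_le hn)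
  have hlogk0 : 0 ≤ Real.logb 2 k := Real.logb_nonneg one_lt_two hk1
  have hpw : P.pw (est i) ≤ 64 * x := by
    refine (pw_le_sq P i).trans ?_
    calc k ^ 2 ≤ (8 * n) ^ 2 := by gcongr
      _ = 64 * (n : ℝ) ^ 2 := by ring
      _ ≤ _ := by gcongr
  have hlogpw : Real.logb 2 (P.pw (est i)) ≤ 8 * L := by
    rw [Params.pw, Real.logb_rpow_eq_mul_logb_of_pos (by linarith)]
    nlinarith
  have hlog2pw : Real.logb 2 (2 * P.pw (est i)) ≤ 9 * L := by
    rw [Real.logb_mul two_ne_zero (by linarith [two_le_pw P i]),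
      Real.logb_self_eq_one one_lt_two]
    linarith
  have hr : P.r (est i) ≤ a * x * L := by
    have h1 : k ^ (2 * (2 + P.ε)) ≤ 8 ^ 6 * x := by
      calc k ^ (2 * (2 + P.ε)) ≤ (8 * (n : ℝ)) ^ (2 * (2 + P.ε)) := by gcongr
        _ = 8 ^ (2 * (2 + P.ε)) * x := Real.mul_rpow (by norm_num) (by linarith)
        _ ≤ 8 ^ (6 : ℝ) * x := by
          gcongr
          · norm_num
          · linarith
        _ = 8 ^ 6 * x := by norm_num
    have h2 : Real.logb 2 (k ^ (2 * (1 + P.ε))) ≤ 16 * L := by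
      rw [Real.logb_rpow_eq_mul_logb_of_pos (by linarith)]
      nlinarith
    have h2' : 0 ≤ Real.logb 2 (k ^ (2 * (1 + P.ε))) :=
      Real.logb_nonneg one_lt_two (Real.one_le_rpow hk1 (by linarith))
    have h3 : Real.logb 2 (2 * k) ≤ 5 * L := by
      rw [Real.logb_mul two_ne_zero (by linarith), Real.logb_self_eq_one one_lt_two]
      linarith
    have h3' : 0 ≤ Real.logb 2 (2 * k) := Real.logb_nonneg one_lt_two (by linarith)
    calc P.r (est i) ≤ 2 * (8 ^ 6 * x) * (16 * L) + 64 * x * (5 * L) := by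
          rw [Params.r]
          change _ + P.pw (est i) * _ ≤ _
          gcongr
      _ = a * x * L := by rw [ha]; ring
  have hD : (P.diffRounds (est i) : ℝ) ≤ a * x * L := by
    rcases le_total 0 (P.r (est i)) with h | h
    · exact (Nat.floor_le h).trans hr
    · rw [Params.diffRounds, Nat.floor_of_nonpos h, Nat.cast_zero]
      positivity
  have hS : (P.dissRounds (est i) : ℝ) ≤ 64 * x :=
    (Nat.floor_le (by linarith [two_le_pw P i])).trans hpw
  have hE : (P.execs (est i) : ℝ) ≤ 34 * (8 + b) * L := by
    refine (execs_le P i).trans ((f_bounds P i).2.trans ?_)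
    have h1 : Real.log (P.pw (est i) / P.ξ) = Real.log (P.pw (est i)) + b := by
      rw [hb, ← Real.log_mul (by linarith [two_le_pw P i]) (by have := P.ξ_pos; positivity),
        mul_one_div]
    have h2 : Real.log (P.pw (est i)) ≤ 8 * L := by
      refine le_trans ?_ hlogpw
      rw [Real.logb, le_div_iff₀ (Real.log_pos one_lt_two)]
      have : 0 ≤ Real.log (P.pw (est i)) := Real.log_nonneg (by linarith [two_le_pw P i])
      nlinarith [Real.log_two_lt_d9]
    have h3 : b ≤ b * L := le_mul_of_one_le_right hb0 hL
    rw [h1]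
    linarith
  have hT := execTime_le P hL hlog2pw
  push_cast
  calc _ ≤ (34 * (8 + b) * L) * (10 * (a * x * L) ^ 2 * L + 64 * x) := by
        gcongr
        exact hT.trans (by gcongr)
    _ ≤ (34 * (8 + b) * L) * (10 * (a * x * L) ^ 2 * L + 64 * (x ^ 2 * L ^ 3)) := by
        have h1 : x ≤ x ^ 2 := le_self_pow₀ hx1 two_ne_zero
        have h2 : x ^ 2 ≤ x ^ 2 * L ^ 3 :=
          le_mul_of_one_le_right (by positivity) (one_le_pow₀ hL)
        gcongr
        exact h1.trans h2
    _ = _ := by rw [hx2]; ring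

section Time

variable (P : Params)

lemma elapsed_zero_eq (i : ℕ) : elapsed P i 0 0
    = ∑ i' ∈ Finset.range i,
      P.execs (est i') * execTime P (est i') (P.numRounds (est i')) := by
  simp [elapsed, execTime]

lemma elapsed_zero_mono : Monotone fun i => elapsed P i 0 0 :=
  monotone_nat_of_le_succ fun i => by
    simp only [elapsed_zero_eq, Finset.sum_range_succ]
    exact Nat.le_add_right _ _

variable {P}

/-- A configuration expires within its own iteration, so only the times at which iterations start
matter for `SolvedWithin`. -/
lemma elapsed_add_cost_le {i e j : ℕ} (h : IsPoint P i e j) :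
    elapsed P i e j + cost P (est i) j ≤ elapsed P (i + 1) 0 0 := by
  rw [elapsed_zero_eq, Finset.sum_range_succ, elapsed, Nat.add_assoc, Nat.add_assoc]
  refine Nat.add_le_add_left ?_ _
  have h1 : execTime P (est i) j + cost P (est i) j ≤ execTime P (est i) (P.numRounds (est i)) := by
    rw [execTime, ← Finset.sum_range_succ]
    exact Finset.sum_le_sum_of_subset (Finset.range_subset_range.2 h.2)
  calc _ ≤ e * execTime P (est i) (P.numRounds (est i))
        + execTime P (est i) (P.numRounds (est i)) := Nat.add_le_add_left h1 _
    _ = (e + 1) * execTime P (est i) (P.numRounds (est i)) := by ring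
    _ ≤ _ := Nat.mul_le_mul_right _ h.1

lemma lt_of_elapsed_lt {i e j i' : ℕ} (h : elapsed P i e j < elapsed P i' 0 0) : i < i' := by
  by_contra! hi
  have h1 := elapsed_zero_mono P hi
  simp only at h1
  have h2 : elapsed P i 0 0 ≤ elapsed P i e j := by
    rw [elapsed_zero_eq, elapsed, Nat.add_assoc]
    exact Nat.le_add_right _ _
  omega

lemma le_of_lt_elapsed_add_cost {i e j i' : ℕ} (hp : IsPoint P i e j)
    (h : elapsed P i' 0 0 < elapsed P i e j + cost P (est i) j) : i' ≤ i := by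
  by_contra! hi
  have h1 := elapsed_zero_mono P hi
  have h2 := elapsed_add_cost_le hp
  simp only [Nat.succ_eq_add_one] at h1
  omega

end Time

/-- The first iteration whose estimate `k` satisfies `2 n ≤ k ^ (1 + ε)`. -/
lemma exists_first_large (P : Params) {n : ℕ} (hn : 1 < n) :
    ∃ i, 2 * (n : ℝ) ≤ P.pw (est i) ∧ P.pw (est i) ≤ 8 * n ∧ (2 : ℝ) ^ i ≤ 2 * n ∧
      ∀ i' ≤ i, (n : ℝ) / 2 < P.pw (est i') → i ≤ i' + 2 := by
  classical
  have hn' : (2 : ℝ) ≤ n := by exact_mod_cast hn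
  have hex : ∃ i, 2 * (n : ℝ) ≤ P.pw (est i) := by
    refine ⟨2 * n, le_trans ?_ (two_pow_le_pw P _)⟩
    have : 2 * n ≤ 2 ^ (2 * n + 1) := (Nat.lt_two_pow_self.le).trans
      (Nat.pow_le_pow_right two_pos (Nat.le_succ _))
    exact_mod_cast this
  obtain ⟨i, hi, hmin⟩ : ∃ i, 2 * (n : ℝ) ≤ P.pw (est i) ∧
      ∀ i' < i, ¬ 2 * (n : ℝ) ≤ P.pw (est i') :=
    ⟨Nat.find hex, Nat.find_spec hex, fun i' h => Nat.find_min hex h⟩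
  refine ⟨i, hi, ?_, ?_, fun i' hi' hlt => ?_⟩
  · cases i with
    | zero =>
      have h1 := pw_le_sq P 0
      norm_num [est] at h1 ⊢
      linarith
    | succ i =>
      have h1 := hmin i (Nat.lt_succ_self i)
      have h2 := (pw_est_succ P i).2
      linarith
  · cases i with
    | zero => norm_num; linarith
    | succ i =>
      have h1 := hmin i (Nat.lt_succ_self i)
      have h2 := two_pow_le_pw P i
      linarith
  -- `K` at least doubles, so two iterations after `K > n/2` it exceeds `2n`.
  · by_contra! h
    have h1 := (pw_est_succ P i').1
    have h2 := (pw_est_succ P (i' + 1)).1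
    exact hmin (i' + 1 + 1) (by omega) (by linarith)

lemma add_two_le_logb {n i : ℕ} (hn : 1 < n) (h : (2 : ℝ) ^ i ≤ 2 * n) :
    (i : ℝ) + 2 ≤ 4 * Real.logb 2 n := by
  refine le_trans ?_ (logb_two_eight_mul_le hn)
  rw [Real.le_logb_iff_rpow_le one_lt_two (by positivity)]
  have : ((i : ℝ) + 2) = ((i + 2 : ℕ) : ℝ) := by push_cast; ring
  rw [this, Real.rpow_natCast, pow_add]
  linarith

lemma messagesSent_eq {V : Type*} [Fintype V] (G : SimpleGraph V) [DecidableRel G.Adj] (T : ℕ) :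
    messagesSent G T = T * (2 * G.edgeFinset.card) := by
  rw [messagesSent, Finset.sum_const, Finset.card_range, smul_eq_mul,
    G.sum_degrees_eq_twice_card_edges]

/-! ### Size of the certificates -/

lemma messagesFit_of_draws {V : Type*} [Fintype V] {P : Params} {G : SimpleGraph V}
    [DecidableRel G.Adj] (hG : G.Connected) {ω : Coins V} {i : ℕ} {B : ℝ}
    (hB : 12 * ((i : ℝ) + 2) ≤ B)
    (hω : ∀ i v, ω.2 (i, v) ∈ Finset.Icc 1 (P.idMax (est i))) :
    MessagesFit P G ω (elapsed P (i + 2) 0 0) B := by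
  intro i' e j _ hlt v K d hv
  have hi' := lt_of_elapsed_lt hlt
  rcases configAt_ldr_eq (P := P) (G := G) (ω := ω) (i := i') hG e j v with h | ⟨a, ha, u, h⟩
  · rw [h] at hv
    exact absurd hv.symm WithBot.coe_ne_bot
  · rw [h] at hv
    obtain ⟨rfl, rfl⟩ := mkCert_inj hv
    have ha' : (a : ℝ) ≤ i := by exact_mod_cast (by omega : a ≤ i)
    have hi0 : (0 : ℝ) ≤ i := Nat.cast_nonneg _
    constructor
    · rw [est, Nat.size_pow]
      push_cast
      linarith
    -- A certificate seen before iteration `i + 2` was drawn in an iteration `a ≤ i`, and `12(a + 1)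
    -- + 9 ≤ 12(i + 2)`.
    · have h1 : (ω.2 (a, u)).size ≤ 12 * (a + 1) + 9 :=
        Nat.size_le.2 ((Finset.mem_Icc.1 (hω a u)).2.trans_lt (idMax_lt P a))
      have h2 : ((ω.2 (a, u)).size : ℝ) ≤ 12 * ((a : ℝ) + 1) + 9 := by exact_mod_cast h1
      linarith

/-! ### Success of the election -/

section Success

variable {V : Type*} [Fintype V] {P : Params} {G : SimpleGraph V}

lemma one_div_le_one_div_rpow_logb {n : ℕ} (hn : 1 < n) :
    1 / (n : ℝ) ≤ 1 / (n : ℝ) ^ Real.logb 2 (8 / 5) := by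
  have hn' : (1 : ℝ) ≤ n := by exact_mod_cast hn.le
  refine one_div_le_one_div_of_le (by positivity) ?_
  refine (Real.rpow_le_rpow_of_exponent_le hn' (?_ : _ ≤ (1 : ℝ))).trans (Real.rpow_one _).le
  rw [Real.logb_le_iff_le_rpow one_lt_two (by norm_num)]
  norm_num

lemma coinLaw_centre_le (hG : G.Connected) : ∃ c : V, ∀ a,
    P.pw (est a) ≤ (Fintype.card V : ℝ) / 2 →
      (coinLaw P V).real {ω | P.f (est a) / 2
        < quietCount ω a P (ballFinset G c (P.dissRounds (est a)))} ≤ P.ξ / P.pw (est a) := by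
  obtain ⟨c, hc⟩ := exists_centre_card_ball hG
  refine ⟨c, fun a ha => (coinLaw_lt_quietCount_le a _ _).trans ?_⟩
  refine pow_mul_exp_le_of_le_third P a (pow_nonneg (one_sub_p_nonneg P a) _)
    (one_sub_p_pow_le_third P a ?_)
  have h2 := two_le_pw P a
  -- Either the ball is everything, with `n ≥ 2K`, or it has `2⌊K⌋ + 1` nodes; the latter is at
  -- least `5(⌊K⌋ + 1)/3` because `⌊K⌋ ≥ 2`.
  rcases hc (P.dissRounds (est a)) with h | h
  · have : (Fintype.card V : ℝ) ≤ (ballFinset G c (P.dissRounds (est a))).card := by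
      exact_mod_cast h
    linarith
  · have h1 : 2 * (P.dissRounds (est a) : ℝ) + 1
        ≤ (ballFinset G c (P.dissRounds (est a))).card := by exact_mod_cast h
    have h3 := (Nat.lt_floor_add_one (P.pw (est a))).le
    have h4 : (2 : ℝ) ≤ P.dissRounds (est a) := by
      exact_mod_cast Nat.le_floor (n := 2) (by exact_mod_cast h2)
    change _ ≤ (P.dissRounds (est a) : ℝ) + 1 at h3
    linarith

lemma sum_div_pw_le (s : Finset ℕ) : ∑ a ∈ s, P.ξ / P.pw (est a) ≤ P.ξ := by
  have h1 : ∀ a ∈ s, P.ξ / P.pw (est a) ≤ P.ξ * (1 / 2 / 2 ^ a) := by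
    intro a _
    rw [div_div, ← pow_succ', mul_one_div]
    exact div_le_div_of_nonneg_left P.ξ_pos.le (by positivity) (two_pow_le_pw P a)
  refine (Finset.sum_le_sum h1).trans ?_
  rw [← Finset.mul_sum]
  have h2 := (summable_geometric_two' 1).sum_le_tsum s fun a _ => by positivity
  rw [tsum_geometric_two'] at h2
  exact mul_le_of_le_one_right P.ξ_pos.le h2

/-- A union bound over at most three iterations and `n²` pairs, each with probability at most
`1/(5n⁴)`. -/
lemma coinLaw_collision_le (hn : 1 < Fintype.card V) {i : ℕ}
    (hi : ∀ a ≤ i, (Fintype.card V : ℝ) / 2 < P.pw (est a) → i ≤ a + 2) :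
    (coinLaw P V).real {ω | ∃ a ≤ i, (Fintype.card V : ℝ) / 2 < P.pw (est a) ∧
      ∃ u v, u ≠ v ∧ ω.2 (a, u) = ω.2 (a, v)} ≤ 1 / Fintype.card V := by
  classical
  set n := Fintype.card V with hndef
  have hn' : (2 : ℝ) ≤ n := by exact_mod_cast hn
  let I : Finset ℕ := (Finset.range (i + 1)).filter fun a => (n : ℝ) / 2 < P.pw (est a)
  have hI : (I.card : ℝ) ≤ 3 := by
    have h1 : I ⊆ Finset.Icc (i - 2) i := by
      intro a ha
      simp only [I, Finset.mem_filter, Finset.mem_range] at ha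
      have := hi a (by omega) ha.2
      rw [Finset.mem_Icc]; omega
    have h2 := Finset.card_le_card h1
    rw [Nat.card_Icc] at h2
    exact_mod_cast (by omega : I.card ≤ 3)
  let J : Finset (ℕ × V × V) := (I ×ˢ Finset.univ).filter fun x => x.2.1 ≠ x.2.2
  have hsub : {ω : Coins V | ∃ a ≤ i, (n : ℝ) / 2 < P.pw (est a) ∧
      ∃ u v, u ≠ v ∧ ω.2 (a, u) = ω.2 (a, v)}
      ⊆ ⋃ x ∈ J, {ω | ω.2 (x.1, x.2.1) = ω.2 (x.1, x.2.2)} := by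
    rintro ω ⟨a, ha, hlt, u, v, huv, h⟩
    refine Set.mem_biUnion (x := (a, u, v)) ?_ h
    simpa [J, I, Nat.lt_succ_iff] using ⟨⟨ha, hlt⟩, huv⟩
  have hterm : ∀ x ∈ J, (coinLaw P V).real {ω | ω.2 (x.1, x.2.1) = ω.2 (x.1, x.2.2)}
      ≤ 1 / (5 * (n : ℝ) ^ 4) := by
    intro x hx
    simp only [J, I, Finset.mem_filter, Finset.mem_product] at hx
    refine (coinLaw_draw_eq_le x.1 hx.2).trans ?_
    exact one_div_le_one_div_of_le (by positivity) (idMax_ge P x.1 hn hx.1.1.2)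
  have hJ : (J.card : ℝ) ≤ 3 * (n : ℝ) ^ 2 := by
    have h1 : J.card ≤ I.card * (n * n) := by
      refine (Finset.card_filter_le _ _).trans (le_of_eq ?_)
      rw [Finset.card_product, Finset.card_univ, Fintype.card_prod]
    have h2 : (J.card : ℝ) ≤ I.card * ((n : ℝ) * n) := by exact_mod_cast h1
    refine h2.trans ?_
    rw [sq]
    gcongr
  calc _ ≤ _ := measureReal_mono hsub (measure_ne_top _ _)
    _ ≤ _ := measureReal_biUnion_finset_le _ _
    _ ≤ _ := Finset.sum_le_sum hterm
    _ = J.card * (1 / (5 * (n : ℝ) ^ 4)) := by rw [Finset.sum_const, nsmul_eq_mul]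
    _ ≤ 3 * (n : ℝ) ^ 2 * (1 / (5 * (n : ℝ) ^ 4)) := by gcongr
    _ ≤ 1 / n := by
      rw [mul_one_div, div_le_div_iff₀ (by positivity) (by positivity)]
      have : (n : ℝ) ^ 3 * 1 ≤ (n : ℝ) ^ 3 * n := by gcongr; linarith
      linarith [show (n : ℝ) ^ 4 = (n : ℝ) ^ 3 * n by ring, show (n : ℝ) ^ 2 * n = n ^ 3 by ring,
        show 0 ≤ (n : ℝ) ^ 3 by positivity]

variable [DecidableRel G.Adj]

/-- The deterministic core. The winner's estimate is at least that of `c`, which is large by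
`hsmall`; so only ties at large estimates matter, and `hdraw` excludes them. -/
lemma solvedWithin_of_good (hG : G.Connected) (hn : 1 < Fintype.card V) {ω : Coins V} {i : ℕ}
    (hi : 2 * (Fintype.card V : ℝ) ≤ P.pw (est i)) (c : V)
    (hsmall : ∀ a ≤ i, P.pw (est a) ≤ (Fintype.card V : ℝ) / 2 →
      (quietCount ω a P (ballFinset G c (P.dissRounds (est a))) : ℝ) ≤ P.f (est a) / 2)
    (hlarge : P.f (est i) / 2 < quietCount ω i P Finset.univ)
    (hwhite : ∃ e < P.execs (est i), ¬ Quiet ω i Finset.univ e)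
    (hdraw : ∀ a ≤ i, (Fintype.card V : ℝ) / 2 < P.pw (est a) →
      ∀ u v, ω.2 (a, u) = ω.2 (a, v) → u = v) :
    SolvedWithin P G ω (elapsed P (i + 2) 0 0) := by
  have := hG.nonempty
  have hall : ∀ v, (iterStart P G ω (i + 1) v).own ≠ ⊥ :=
    iterStart_succ_own_ne_bot hG hn (mixing_of_le P i hn hi) hlarge hwhite
  obtain ⟨w, -, hw⟩ := Finset.exists_max_image Finset.univ
    (fun v => (iterStart P G ω (i + 1) v).own) Finset.univ_nonempty
  have hform := fun v => (iterStart_own_eq (P := P) (ω := ω) (i := i + 1) hG v).resolve_left (hall v)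
  obtain ⟨a, ha, hac, hacount⟩ := hform c
  obtain ⟨b, hb, hbw, -⟩ := hform w
  have hpa : (Fintype.card V : ℝ) / 2 < P.pw (est a) := by
    by_contra! h
    exact absurd hacount (hsmall a (by omega) h).not_gt
  have hab : a ≤ b := by
    have := hw c (Finset.mem_univ c)
    rw [hac, hbw] at this
    exact est_strictMono.le_iff_le.1 (le_of_mkCert_le this)
  have huniq : ∀ u, (iterStart P G ω (i + 1) u).own = (iterStart P G ω (i + 1) w).own →
      u = w := by
    intro u hu
    obtain ⟨b', -, hbu, -⟩ := hform u
    rw [hbu, hbw] at hu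
    obtain ⟨h1, h2⟩ := mkCert_inj hu
    obtain rfl := est_strictMono.injective h1
    exact hdraw b' (by omega) (hpa.trans_le (pw_est_mono P hab)) u w h2
  have hi' : 2 * (Fintype.card V : ℝ) ≤ P.pw (est (i + 1)) :=
    hi.trans (pw_est_mono P (Nat.le_succ i))
  refine ⟨w, fun i' e j hp hT => ?_⟩
  exact elected_of_unique_max hG hall (fun u => hw u (Finset.mem_univ u)) huniq
    ((le_dissRounds P (i + 1) hi').trans (Nat.le_add_left _ _)) (execs_pos P (i + 1))
    (le_of_lt_elapsed_add_cost hp hT) e j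

lemma coinLaw_solvedWithin_ge (hG : G.Connected) (hn : 1 < Fintype.card V) {i : ℕ}
    (hi : 2 * (Fintype.card V : ℝ) ≤ P.pw (est i))
    (hi' : P.pw (est i) ≤ 8 * Fintype.card V)
    (hlast : ∀ a ≤ i, (Fintype.card V : ℝ) / 2 < P.pw (est a) → i ≤ a + 2) :
    1 - 1 / (Fintype.card V : ℝ) - 2 * P.ξ
      ≤ (coinLaw P V).real {ω | SolvedWithin P G ω (elapsed P (i + 2) 0 0)} := by
  classical
  have hn' : (2 : ℝ) ≤ Fintype.card V := by exact_mod_cast hn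
  obtain ⟨c, hc⟩ := coinLaw_centre_le (P := P) hG
  let I : Finset ℕ :=
    (Finset.range (i + 1)).filter fun a => P.pw (est a) ≤ (Fintype.card V : ℝ) / 2
  let S : Set (Coins V) := {ω | SolvedWithin P G ω (elapsed P (i + 2) 0 0)}
  let B₁ : Set (Coins V) := ⋃ a ∈ I, {ω | P.f (est a) / 2
        < quietCount ω a P (ballFinset G c (P.dissRounds (est a)))}
  let B₂ : Set (Coins V) := {ω | (quietCount ω i P Finset.univ : ℝ) ≤ P.f (est i) / 2}
  let B₃ : Set (Coins V) :=
    ⋂ e ∈ Finset.range (P.execs (est i)), {ω | Quiet ω i Finset.univ e}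
  let B₄ : Set (Coins V) := {ω | ∃ a ≤ i, (Fintype.card V : ℝ) / 2 < P.pw (est a) ∧
      ∃ u v, u ≠ v ∧ ω.2 (a, u) = ω.2 (a, v)}
  -- Covering the whole space by the success event and four bad events bounds the former from below
  -- by subadditivity alone, without its measurability.
  have hcover : Set.univ ⊆ S ∪ (B₁ ∪ (B₂ ∪ (B₃ ∪ B₄))) := by
    intro ω _
    by_contra hω
    simp only [Set.mem_union, not_or] at hω
    obtain ⟨hS, h1, h2, h3, h4⟩ := hω
    refine hS (solvedWithin_of_good hG hn hi c (fun a ha hpa => ?_) (not_le.1 h2) ?_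
      fun a ha hpa u v huv => ?_)
    · by_contra! h
      refine h1 (Set.mem_biUnion (x := a) ?_ h)
      simpa [I, Nat.lt_succ_iff] using ⟨ha, hpa⟩
    · by_contra! h
      exact h3 (Set.mem_iInter₂.2 fun e he => h e (Finset.mem_range.1 he))
    · by_contra h
      exact h4 ⟨a, ha, hpa, u, v, h, huv⟩
  have hp0 := one_sub_p_nonneg P i
  have hp1 : 1 - P.p (est i) ≤ 1 := by linarith [(p_mem P i).1]
  have b1 : (coinLaw P V).real B₁ ≤ P.ξ := by
    refine (measureReal_biUnion_finset_le _ _).trans ?_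
    refine (Finset.sum_le_sum fun a ha => hc a ?_).trans (sum_div_pw_le I)
    exact (Finset.mem_filter.1 ha).2
  have b2 : (coinLaw P V).real B₂ ≤ 3 / 2 * (P.ξ / P.pw (est i)) :=
    (coinLaw_quietCount_le_le i _ _).trans (pow_mul_exp_le_of_ge P i
      (one_sub_p_pow_ge P i (by rwa [Finset.card_univ])) (pow_le_one₀ hp0 hp1))
  have b3 : (coinLaw P V).real B₃ ≤ 2 * (P.ξ / P.pw (est i)) := by
    refine (coinLaw_quiet i _ _).trans_le ?_
    rw [Finset.card_range, Finset.card_univ]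
    exact one_sub_p_pow_pow_execs_le P i hi hi'
  have b4 : (coinLaw P V).real B₄ ≤ 1 / Fintype.card V := coinLaw_collision_le hn hlast
  -- `K ≥ 2n ≥ 4` makes `B₂` and `B₃` together cost at most `(7/2)(ξ/4) < ξ`; `B₁` costs the other
  -- `ξ`.
  have b5 : P.ξ / P.pw (est i) ≤ P.ξ / 4 :=
    div_le_div_of_nonneg_left P.ξ_pos.le (by norm_num) (by linarith)
  have htotal := measureReal_mono (μ := coinLaw P V) hcover
  rw [probReal_univ] at htotal
  have u1 := measureReal_union_le (μ := coinLaw P V) S (B₁ ∪ (B₂ ∪ (B₃ ∪ B₄)))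
  have u2 := measureReal_union_le (μ := coinLaw P V) B₁ (B₂ ∪ (B₃ ∪ B₄))
  have u3 := measureReal_union_le (μ := coinLaw P V) B₂ (B₃ ∪ B₄)
  have u4 := measureReal_union_le (μ := coinLaw P V) B₃ B₄
  have := P.ξ_pos
  change _ ≤ (coinLaw P V).real S
  linarith

end Success

end RevocableLE

end

/-! ### Assembly of the main theorem -/

open RevocableLE

theorem mainTheorem4 (P : RevocableLE.Params) :
    ∃ C : ℝ, 0 < C ∧
      ∀ (V : Type*) [Fintype V] (G : SimpleGraph V) [DecidableRel G.Adj],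
        G.Connected → 1 < Fintype.card V →
        ∃ T : ℕ,
          (T : ℝ) ≤ C * (Fintype.card V : ℝ) ^ (4 * (2 + P.ε))
            * Real.logb 2 (Fintype.card V) ^ 5 ∧
          (RevocableLE.messagesSent G T : ℝ) ≤ C * (Fintype.card V : ℝ) ^ (4 * (2 + P.ε))
            * (G.edgeFinset.card : ℝ) * Real.logb 2 (Fintype.card V) ^ 5 ∧
          (∀ᵐ ω ∂(RevocableLE.coinLaw P V),
            RevocableLE.MessagesFit P G ω T (C * Real.logb 2 (Fintype.card V))) ∧
          1 - 1 / (Fintype.card V : ℝ) ^ Real.logb 2 (8 / 5) - 2 * P.ξ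
            ≤ (RevocableLE.coinLaw P V).real {ω | RevocableLE.SolvedWithin P G ω T} := by
  obtain ⟨C, hC, htime⟩ := exists_iteration_time_le P
  -- `8C` covers the `2m` messages per round over `4C X L⁵` rounds; `48` covers certificates of
  -- `12(i + 2) ≤ 48 L` bits.
  refine ⟨8 * C + 48, by positivity, fun V _ G _ hG hn => ?_⟩
  obtain ⟨i, hi, hi', hpow, hlast⟩ := exists_first_large P hn
  set n := Fintype.card V with hndef
  set L := Real.logb 2 n with hLdef
  have hL : 1 ≤ L := one_le_logb_two hn
  have hiL : (i : ℝ) + 2 ≤ 4 * L := add_two_le_logb hn hpow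
  set X := (n : ℝ) ^ (4 * (2 + P.ε)) with hX
  have hX0 : 0 ≤ X := by positivity
  have hT : (elapsed P (i + 2) 0 0 : ℝ) ≤ 4 * C * X * L ^ 5 := by
    rw [elapsed_zero_eq, Nat.cast_sum]
    have h1 : ∀ a ∈ Finset.range (i + 2),
        ((P.execs (est a) * execTime P (est a) (P.numRounds (est a)) : ℕ) : ℝ)
          ≤ C * X * L ^ 4 := by
      intro a ha
      refine htime n hn a ?_
      have h2 : est a ≤ 2 ^ (i + 2) :=
        Nat.pow_le_pow_right two_pos (by have := Finset.mem_range.1 ha; omega)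
      have h3 : (est a : ℝ) ≤ 2 ^ (i + 2) := by exact_mod_cast h2
      rw [pow_add] at h3
      linarith
    refine (Finset.sum_le_sum h1).trans ?_
    rw [Finset.sum_const, Finset.card_range, nsmul_eq_mul]
    push_cast
    calc ((i : ℝ) + 2) * (C * X * L ^ 4) ≤ 4 * L * (C * X * L ^ 4) := by gcongr
      _ = _ := by ring
  refine ⟨elapsed P (i + 2) 0 0, ?_, ?_, ?_, ?_⟩
  · refine hT.trans ?_
    gcongr
    linarith
  · rw [messagesSent_eq]
    push_cast
    calc (elapsed P (i + 2) 0 0 : ℝ) * (2 * (G.edgeFinset.card : ℝ))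
        ≤ 4 * C * X * L ^ 5 * (2 * (G.edgeFinset.card : ℝ)) := by gcongr
      _ = 8 * C * X * (G.edgeFinset.card : ℝ) * L ^ 5 := by ring
      _ ≤ _ := by gcongr; linarith
  · have hae : ∀ᵐ ω ∂coinLaw P V, ∀ i v, ω.2 (i, v) ∈ Finset.Icc 1 (P.idMax (est i)) :=
      ae_all_iff.2 fun i => ae_all_iff.2 fun v => ae_draw_mem_Icc P V i v
    filter_upwards [hae] with ω hω
    refine messagesFit_of_draws hG ?_ hω
    have : 0 ≤ C * L := by positivity
    linarith
  · refine le_trans ?_ (coinLaw_solvedWithin_ge hG hn hi hi' hlast)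
    linarith [one_div_le_one_div_rpow_logb hn]
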